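/- Let $p$ be a prime, let $E=K_1\times\cdots\times K_m$ be a product of finite field extensions $K_i/\mathbb{Q}_p$ with $r_i=[K_i:\mathbb{Q}_p]$ and $r=r_1+\cdots+r_m$, and let $\mathcal{O}_E$ be the ring of elements of $E$ integral over $\mathbb{Z}_p$. Let $e_i$ be the ramification index of $K_i/\mathbb{Q}_p$, and let $\mathrm{val}$ be the valuation on each $K_i$ extending the $p$-adic one, with $\mathrm{val}(p)=1$ and $\mathrm{val}(0)=\infty$. Let $\mathfrak{x}=(x_1,\ldots,x_m)\in\mathcal{O}_E$ be such that $E=\mathbb{Q}_p[\mathfrak{x}]$, let $Z$ be the product of the minimal polynomials of $x_1,\ldots,x_m$ over $\mathbb{Q}_p$, and let $\mathrm{Disc}(\mathfrak{x})$ be the discriminant of $Z$. Fix $s=(s_1,\ldots,s_m)$ with $s_i\in\frac{1}{e_i}\mathbb{N}$ and $s_i>r\,\mathrm{val}\,\mathrm{Disc}(\mathfrak{x})$ for all $i$, and put $$F_Z=\{f\in\mathbb{Z}_p[x] : \deg f\le r-1,\ \mathrm{val}(f(x_i)-x_i)+\mathrm{val}\,Z'(x_i)\ge s_i\text{ for all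 }1\le i\le m\}.$$ Let $\mathcal{C}$ be a class, modulo multiplication by $E^\times$, of $\mathbb{Z}_p$-lattices $M\subset E$ of rank $r$ that are $\mathbb{Z}_p[\mathfrak{x}]$-modules. Let $\mathrm{End}(\mathcal{C})$ be the ring of $\mathbb{Q}_p$-linear maps $T:E\to E$ that commute with multiplication by $\mathfrak{x}$ and satisfy $TM\subset M$ for one (equivalently, every) $M\in\mathcal{C}$. Fix a $\mathbb{Z}_p$-basis of some $M\in\mathcal{C}$ and let $A_{\mathcal{C}}\in\mathrm{Mat}_r(\mathbb{Z}_p)$ be the matrix of multiplication by $\mathfrak{x}$ in this basis. Regard $\mathcal{O}_E$ as a ring of linear maps on $E$ through its action by multiplication. Then $\mathrm{End}(\mathcal{C})\subset\mathcal{O}_E$, the quotient $\mathcal{O}_E/\mathrm{End}(\mathcal{C})$ (of additive groups) is finite, and for all sufficiently large integers $\mathcal{M}$ the set $$\{(I_r+\Delta T)f(A_{\mathcal{C}})(I_r+\Delta T)^{-1} : \Delta T\in p^{\mathcal{M}}\mathrm{Mat}_r(\mathbb{Z}_p),\ f\in F_Z\}$$ is Borel measurable and, for the additive Haar probability measure $\mathbf{P}$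 on $\mathrm{Mat}_r(\mathbb{Z}_p)$, has measure $$\mathbf{P}\left(\{(I_r+\Delta T)f(A_{\mathcal{C}})(I_r+\Delta T)^{-1} : \Delta T\in p^{\mathcal{M}}\mathrm{Mat}_r(\mathbb{Z}_p),\ f\in F_Z\}\right)=\frac{\#(\mathcal{O}_E/\mathrm{End}(\mathcal{C}))}{p^{\sum_{i=1}^m s_ir_i+\mathcal{M}(r^2-r)}}.$$ -/

import Mathlib

open Polynomial

noncomputable section

section Lattices

set_option linter.unusedSectionVars false

variable {p : ℕ} [Fact p.Prime] {E : Type*} [CommRing E] [Algebra ℚ_[p] E] [Algebra ℤ_[p] E]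
  [IsScalarTower ℤ_[p] ℚ_[p] E]

/-- The set `Mod_{ℤ_p[x]}`: the `ℤ_p`-lattices of full rank in the `ℚ_p`-algebra `E` that are
stable under multiplication by the subring `ℤ_p[x]`. -/
structure LatticeModule (p : ℕ) [Fact p.Prime] {E : Type*} [CommRing E] [Algebra ℚ_[p] E]
    [Algebra ℤ_[p] E] [IsScalarTower ℤ_[p] ℚ_[p] E] (x : E) where
  toSubmodule : Submodule ℤ_[p] E
  isLattice : Submodule.IsLattice ℚ_[p] toSubmodule
  mul_mem : ∀ a ∈ Algebra.adjoin ℤ_[p] {x}, ∀ y ∈ toSubmodule, a * y ∈ toSubmodule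

/-- Two lattices are equivalent when `M₂ = u M₁` for some unit `u` of `E`. -/
def LatticeModule.setoid (p : ℕ) [Fact p.Prime] {E : Type*} [CommRing E] [Algebra ℚ_[p] E]
    [Algebra ℤ_[p] E] [IsScalarTower ℤ_[p] ℚ_[p] E] (x : E) : Setoid (LatticeModule p x) where
  r M₁ M₂ := ∃ u : Eˣ,
    (M₂.toSubmodule : Set E) = (fun y => (u : E) * y) '' (M₁.toSubmodule : Set E)
  iseqv :=
    { refl := fun M => ⟨1, by simp⟩
      symm := by
        rintro M₁ M₂ ⟨u, h⟩
        refine ⟨u⁻¹, ?_⟩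
        rw [h, Set.image_image]
        simp
      trans := by
        rintro M₁ M₂ M₃ ⟨u, h⟩ ⟨v, h'⟩
        refine ⟨v * u, ?_⟩
        rw [h', h, Set.image_image]
        simp [mul_assoc] }

/-- The set of classes `Eˣ \ Mod_{ℤ_p[x]}`. -/
def LatticeClass (p : ℕ) [Fact p.Prime] {E : Type*} [CommRing E] [Algebra ℚ_[p] E]
    [Algebra ℤ_[p] E] [IsScalarTower ℤ_[p] ℚ_[p] E] (x : E) : Type _ :=
  Quotient (LatticeModule.setoid p x)

/-- The class `[M]` of a lattice `M`. -/
def LatticeModule.cls {x : E} (M : LatticeModule p x) : LatticeClass p x :=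
  Quotient.mk (LatticeModule.setoid p x) M

/-- `End(M)`: the `ℚ_p`-linear maps on `E` that preserve `M` and commute with multiplication
by `x`. -/
def LatticeModule.endo {x : E} (M : LatticeModule p x) : Subring (Module.End ℚ_[p] E) where
  carrier := {T | (∀ y ∈ M.toSubmodule, T y ∈ M.toSubmodule) ∧ ∀ y, T (x * y) = x * T y}
  add_mem' := by
    rintro S T ⟨hS, hS'⟩ ⟨hT, hT'⟩
    exact ⟨fun y hy => M.toSubmodule.add_mem (hS y hy) (hT y hy), fun y => by
      simp [hS', hT', mul_add]⟩
  zero_mem' := ⟨fun y _ => M.toSubmodule.zero_mem, fun y => by simp⟩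
  neg_mem' := by
    rintro T ⟨hT, hT'⟩
    exact ⟨fun y hy => M.toSubmodule.neg_mem (hT y hy), fun y => by simp [hT']⟩
  mul_mem' := by
    rintro S T ⟨hS, hS'⟩ ⟨hT, hT'⟩
    exact ⟨fun y hy => hS _ (hT y hy), fun y => by simp [hS', hT']⟩
  one_mem' := ⟨fun y hy => hy, fun y => rfl⟩

/-- The matrix by which `x` acts on the `ℤ_p`-basis `v` of `M` (column `j` holds the coordinates
of `x * v j`). -/
def LatticeModule.actionMatrix {x : E} (M : LatticeModule p x) {r : ℕ}
    (v : Module.Basis (Fin r) ℤ_[p] M.toSubmodule) : Matrix (Fin r) (Fin r) ℤ_[p] :=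
  LinearMap.toMatrix v v ((LinearMap.mulLeft ℤ_[p] x).restrict (p := M.toSubmodule)
    (q := M.toSubmodule) (fun y hy => M.mul_mem x (Algebra.self_mem_adjoin_singleton _ x) y hy))

/-- When `x` generates `E` over `ℚ_p`, a `ℚ_p`-linear map that commutes with multiplication by `x`
commutes with multiplication by every element of `E`. -/
theorem LatticeModule.endo_comm {x : E} (hx : Algebra.adjoin ℚ_[p] {x} = ⊤)
    (T : Module.End ℚ_[p] E) (hT : ∀ y, T (x * y) = x * T y) (a y : E) :
    T (a * y) = a * T y := by
  have ha : a ∈ Algebra.adjoin ℚ_[p] {x} := by rw [hx]; trivial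
  induction ha using Algebra.adjoin_induction generalizing y with
  | mem b hb => rw [Set.mem_singleton_iff.1 hb]; exact hT y
  | algebraMap c => rw [← Algebra.smul_def, ← Algebra.smul_def, map_smul]
  | add b c _ _ h₁ h₂ => rw [add_mul, add_mul, map_add, h₁, h₂]
  | mul b c _ _ h₁ h₂ => rw [mul_assoc, mul_assoc, h₁, h₂]

/-- `End(C) = End(M)` for any representative `M` of the class `C`; this is well defined when `x`
generates `E` over `ℚ_p`. -/
def LatticeClass.endo {x : E} (hx : Algebra.adjoin ℚ_[p] {x} = ⊤) (C : LatticeClass p x) :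
    Subring (Module.End ℚ_[p] E) :=
  Quotient.lift (s := LatticeModule.setoid p x) (fun M => M.endo) (by
    have key : ∀ M₁ M₂ : LatticeModule p x, (LatticeModule.setoid p x).r M₁ M₂ →
        M₁.endo ≤ M₂.endo := by
      rintro M₁ M₂ ⟨u, h⟩ T ⟨hT, hT'⟩
      refine ⟨fun y hy => ?_, hT'⟩
      have hy' : y ∈ (M₂.toSubmodule : Set E) := hy
      rw [h] at hy'
      obtain ⟨z, hz, rfl⟩ := hy'
      have : T ((u : E) * z) ∈ (M₂.toSubmodule : Set E) := by
        rw [h]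
        exact ⟨T z, hT z hz, (LatticeModule.endo_comm hx T hT' _ _).symm⟩
      exact this
    intro M₁ M₂ h
    exact le_antisymm (key _ _ h) (key _ _ ((LatticeModule.setoid p x).symm h))) C

/-- The maximal order `O_E` (the elements of `E` integral over `ℤ_p`), acting on `E` by
multiplication. -/
def maximalOrderEnd (p : ℕ) [Fact p.Prime] (E : Type*) [CommRing E] [Algebra ℚ_[p] E]
    [Algebra ℤ_[p] E] [IsScalarTower ℤ_[p] ℚ_[p] E] :
    Subring (Module.End ℚ_[p] E) :=
  (integralClosure ℤ_[p] E).toSubring.map (Algebra.lmul ℚ_[p] E).toRingHom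

/-- The quotient `O_E / End(C)` (of additive groups), both being regarded as rings of `ℚ_p`-linear
maps on `E`. -/
abbrev LatticeClass.OrderQuotient {x : E} (hx : Algebra.adjoin ℚ_[p] {x} = ⊤)
    (C : LatticeClass p x) : Type _ :=
  (maximalOrderEnd p E).toAddSubgroup ⧸
    (C.endo hx).toAddSubgroup.addSubgroupOf (maximalOrderEnd p E).toAddSubgroup

end Lattices

section Polynomials

/-- The valuation on a finite extension `K` of `ℚ_p`, normalized by `val p = 1`, with
`val 0 = ∞`: `val y = - log_p ‖y‖` for the unique extension `‖·‖` of the `p`-adic norm. -/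
def extVal (p : ℕ) [Fact p.Prime] {K : Type*} [Field K] [Algebra ℚ_[p] K] (y : K) : WithTop ℝ :=
  open Classical in
  if y = 0 then ⊤ else ((-Real.logb p (spectralNorm ℚ_[p] K y) : ℝ) : WithTop ℝ)

variable {p : ℕ} [Fact p.Prime] {m : ℕ} {K : Fin m → Type*} [∀ i, Field (K i)]
  [∀ i, Algebra ℚ_[p] (K i)]

/-- `Z`, the product of the minimal polynomials of the `x i` over `ℚ_p`. -/
def minpolyProd (p : ℕ) [Fact p.Prime] {m : ℕ} {K : Fin m → Type*} [∀ i, Field (K i)]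
    [∀ i, Algebra ℚ_[p] (K i)] (x : ∀ i, K i) : ℚ_[p][X] :=
  ∏ i, minpoly ℚ_[p] (x i)

/-- `val Disc(x)`, where `Disc(x)` is the discriminant of `Z`, a nonzero element of `ℚ_p` when
`x` generates `∏ i, K i` over `ℚ_p`. -/
def valDisc (p : ℕ) [Fact p.Prime] {m : ℕ} {K : Fin m → Type*} [∀ i, Field (K i)]
    [∀ i, Algebra ℚ_[p] (K i)] (x : ∀ i, K i) : ℤ :=
  (minpolyProd p x).discr.valuation

/-- The set `F_{Z,s}` of the `f ∈ ℤ_p[X]` of degree at most `r - 1` with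
`val (f(x_i) - x_i) + val Z'(x_i) ≥ s_i` for all `i`. -/
def nearIdPolys [∀ i, Algebra ℤ_[p] (K i)] (r : ℕ) (x : ∀ i, K i) (s : Fin m → ℝ) :
    Set ℤ_[p][X] :=
  {f | f.degree < (r : WithBot ℕ) ∧ ∀ i, ((s i : ℝ) : WithTop ℝ) ≤
    extVal p (aeval (x i) f - x i) + extVal p (aeval (x i) (derivative (minpolyProd p x)))}

/-- The set of the matrices `(I + ΔT) f(A) (I + ΔT)⁻¹` with `ΔT ∈ p^N Mat_r(ℤ_p)`, `f ∈ F`. -/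
def conjugateSet {r : ℕ} (A : Matrix (Fin r) (Fin r) ℤ_[p]) (F : Set ℤ_[p][X]) (N : ℕ) :
    Set (Matrix (Fin r) (Fin r) ℤ_[p]) :=
  {B | ∃ T : Matrix (Fin r) (Fin r) ℤ_[p], ∃ f ∈ F,
    B = (1 + (p : ℤ_[p]) ^ N • T) * aeval A f * (1 + (p : ℤ_[p]) ^ N • T)⁻¹}

end Polynomials

end

noncomputable section

/-! ### Indices, compactness and Haar measure for `ℤ_p`-lattices -/

section PadicLattices

variable {p : ℕ} [Fact p.Prime]

/-! Write `O_E` for the maximal order, `R` for `End(C)` viewed inside `E`, and `[T, F] = T F - F T`.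
The `r` embeddings of `E` into an algebraic closure diagonalize multiplication by every element of
`E`. Choose a unit `u` of `E` with `val u_i + val Z'(x_i) = s_i`. Then `f ∈ F_Z` means `deg f < r`
and `f(x) - x ∈ u O_E`. Since `s_i > r val Disc`, every conjugate of `u` is smaller than the
discriminant, and Cramer's rule for the Vandermonde matrix gives `u O_E ⊆ ℤ_p[x] ⊆ R`. So the
matrices `f(A)` fill the coset `A + Λ`, where `Λ` consists of the matrices of multiplication by `u
O_E` (`image_aeval_eq_add_multiplesMatrix`).

Conjugation is then linearized: `(1 + qT) F (1 + qT)⁻¹ = F + q [T, F]` modulo `q²`. The image of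
`[·, F]` is the same for all `F ∈ A + Λ`, because `f(x)` is so close to `x` that it generates the
same order (`exists_aeval_aeval_eq_self`). Hence for large `N` the set is exactly the coset `A + (Λ
⊕ p^N [Mat, A])`: one inclusion is the expansion (`nearConjugates_subset`), the other a Newton
iteration (`exists_nearConjugates_approx`) and compactness. Its measure is the inverse of the index
of a lattice.

For that index, `[·, A]` is semisimple, its eigenvalues are the differences of the conjugates of
`x`, and its kernel is `R`, of rank `r`. So `R ⊕ p^N [Mat, A]` has index `p^(N(r²-r)) / |Disc|`
(`index_ker_sup_range_commMap`), while `[R : u O_E] = |N(u)|⁻¹ / #(O_E / R)`. Finally `|N(u)|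
|Disc|` is the product of `|u| |Z'(x)|` over all conjugates, that is, `p^(-∑ s_i r_i)`. -/

theorem PadicInt.card_quotient_span_singleton {a : ℤ_[p]} (ha : a ≠ 0) :
    (Nat.card (ℤ_[p] ⧸ Ideal.span {a}) : ℝ) = ‖a‖⁻¹ := by
  have h1 : Ideal.span {a} = RingHom.ker (PadicInt.toZModPow (p := p) a.valuation) := by
    rw [PadicInt.ker_toZModPow, Ideal.span_singleton_eq_span_singleton]
    refine ⟨(PadicInt.unitCoeff ha)⁻¹, ?_⟩
    have h := PadicInt.unitCoeff_spec ha
    generalize PadicInt.unitCoeff ha = w at h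
    generalize a.valuation = n at h
    rw [h, mul_comm, ← mul_assoc, Units.inv_mul, one_mul]
  rw [h1, Nat.card_congr (RingHom.quotientKerEquivOfSurjective
    (ZMod.ringHom_surjective (PadicInt.toZModPow (p := p) a.valuation))).toEquiv, Nat.card_zmod,
    PadicInt.norm_eq_zpow_neg_valuation ha]
  simp

/-- The index of the image of an injective endomorphism of a lattice. -/
theorem LinearMap.card_quotient_range {L : Type*} [AddCommGroup L] [Module ℤ_[p] L]
    [Module.Free ℤ_[p] L] [Module.Finite ℤ_[p] L] (φ : L →ₗ[ℤ_[p]] L)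
    (hφ : LinearMap.det φ ≠ 0) :
    (Nat.card (L ⧸ LinearMap.range φ) : ℝ) = ‖LinearMap.det φ‖⁻¹ := by
  have hinj : Function.Injective φ := by
    rw [← LinearMap.ker_eq_bot]
    by_contra hne
    exact hφ (LinearMap.det_eq_zero_iff_ker_ne_bot.2 hne)
  let b := Module.Free.chooseBasis ℤ_[p] L
  let e₀ : L ≃ₗ[ℤ_[p]] LinearMap.range φ := LinearEquiv.ofInjective φ hinj
  have h : Module.finrank ℤ_[p] (LinearMap.range φ) = Module.finrank ℤ_[p] L :=
    e₀.symm.finrank_eq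
  let a := Submodule.smithNormalFormCoeffs b h
  let b' := Submodule.smithNormalFormTopBasis b h
  let ab := Submodule.smithNormalFormBotBasis b h
  have ab_eq := Submodule.smithNormalFormBotBasis_def b h
  let e' : L ≃ₗ[ℤ_[p]] LinearMap.range φ := b'.equiv ab (Equiv.refl _)
  -- In Smith bases this map is diagonal. It differs from `φ` by an automorphism of `L`, so the
  -- determinants agree up to a unit.
  let f : L →ₗ[ℤ_[p]] L := (LinearMap.range φ).subtype.comp (e' : L →ₗ[ℤ_[p]] _)
  have hφe : φ = (LinearMap.range φ).subtype.comp (e₀ : L →ₗ[ℤ_[p]] _) := by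
    ext y; rfl
  have hassoc : Associated (LinearMap.det φ) (LinearMap.det f) := by
    conv_lhs => rw [hφe]
    exact LinearMap.associated_det_comp_equiv _ _ _
  have hdet : LinearMap.det f = ∏ i, a i := by
    rw [← LinearMap.det_toMatrix b', ← Matrix.det_diagonal]
    congr 1
    ext i j
    have : f (b' j) = a j • b' j := by
      change ((b'.equiv ab (Equiv.refl _) (b' j) : LinearMap.range φ) : L) = _
      rw [b'.equiv_apply, Equiv.refl_apply]
      exact ab_eq j
    rw [LinearMap.toMatrix_apply, this, map_smul, Module.Basis.repr_self, Finsupp.smul_single,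
      smul_eq_mul, mul_one]
    by_cases h : i = j
    · rw [h, Matrix.diagonal_apply_eq, Finsupp.single_eq_same]
    · rw [Matrix.diagonal_apply_ne _ h, Finsupp.single_eq_of_ne h]
  have hnorm : ‖LinearMap.det φ‖ = ∏ i, ‖a i‖ := by
    obtain ⟨w, hw⟩ := hassoc
    rw [← norm_prod, ← hdet, ← hw, norm_mul, PadicInt.norm_units, mul_one]
  rw [hnorm, Nat.card_congr (Submodule.quotientEquivPiSpan _ b h).toEquiv, Nat.card_pi,
    Nat.cast_prod, ← Finset.prod_inv_distrib]
  exact Finset.prod_congr rfl fun i _ => PadicInt.card_quotient_span_singleton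
    (Submodule.smithNormalFormCoeffs_ne_zero b h i)

theorem Submodule.isCompact_of_isNoetherian {V : Type*} [AddCommGroup V] [Module ℤ_[p] V]
    [TopologicalSpace V] [IsTopologicalAddGroup V] [ContinuousSMul ℤ_[p] V]
    [IsNoetherian ℤ_[p] V] (N : Submodule ℤ_[p] V) : IsCompact (N : Set V) := by
  obtain ⟨n, s, hs⟩ := Submodule.fg_iff_exists_fin_generating_family.1 (IsNoetherian.noetherian N)
  have : (N : Set V) = Set.range (Fintype.linearCombination ℤ_[p] s) := by
    rw [← hs, ← LinearMap.coe_range, Fintype.range_linearCombination]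
  rw [this]
  exact isCompact_range (LinearMap.continuous_on_pi _)

/-- Finitely many cosets, all of equal measure by invariance, partition a group of measure one. -/
theorem measureReal_vadd_addSubgroup {G : Type*} [AddCommGroup G] [TopologicalSpace G]
    [IsTopologicalAddGroup G] [MeasurableSpace G] [BorelSpace G] (μ : MeasureTheory.Measure G)
    [μ.IsAddHaarMeasure] [MeasureTheory.IsProbabilityMeasure μ] (H : AddSubgroup G)
    (hH : IsClosed (H : Set G)) (hidx : H.index ≠ 0) (a : G) :
    μ.real ((fun h => a + h) '' (H : Set G)) = (H.index : ℝ)⁻¹ := by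
  have : H.FiniteIndex := ⟨hidx⟩
  have h1 := MeasureTheory.AddSubgroup.index_mul_measure H hH.measurableSet μ
  have h2 : μ ((fun h => a + h) '' (H : Set G)) = μ (H : Set G) := by
    rw [Set.image_add_left, MeasureTheory.measure_preimage_add]
  rw [MeasureTheory.measureReal_def, h2]
  have h3 := congrArg ENNReal.toReal h1
  rw [ENNReal.toReal_mul, MeasureTheory.measure_univ] at h3
  simp only [ENNReal.toReal_natCast, ENNReal.toReal_one] at h3
  exact eq_inv_of_mul_eq_one_right h3

end PadicLattices

/-! ### Integrality in terms of norms -/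

section IntegralElements

/-- The product of monic polynomials that kill the separate coordinates kills every coordinate. -/
theorem isIntegral_pi {R ι : Type*} [CommRing R] [Fintype ι] {B : ι → Type*} [∀ i, CommRing (B i)]
    [∀ i, Algebra R (B i)] {y : ∀ i, B i} (h : ∀ i, IsIntegral R (y i)) : IsIntegral R y := by
  choose P hP hy using h
  refine ⟨∏ i, P i, monic_prod_of_monic _ _ fun i _ => hP i, ?_⟩
  rw [← aeval_def]
  funext i
  have := (aeval_algHom_apply (Pi.evalAlgHom R B i) y (∏ i, P i)).symm
  simp only [Pi.evalAlgHom_apply] at this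
  rw [this, map_prod]
  exact Finset.prod_eq_zero (Finset.mem_univ i) (by rw [aeval_def]; exact hy i)

variable {p : ℕ} [Fact p.Prime]

/-- Both sides say that the minimal polynomial over `ℚ_p` has coefficients in `ℤ_p`; for integral
`y` this holds because `ℤ_p` is integrally closed. -/
theorem spectralNorm_le_one_iff_isIntegral {K : Type*} [Field K] [Algebra ℚ_[p] K]
    [Algebra.IsAlgebraic ℚ_[p] K] [Algebra ℤ_[p] K] [IsScalarTower ℤ_[p] ℚ_[p] K] (y : K) :
    spectralNorm ℚ_[p] K y ≤ 1 ↔ IsIntegral ℤ_[p] y := by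
  have hy : IsIntegral ℚ_[p] y := Algebra.IsIntegral.isIntegral y
  rw [spectralNorm, spectralValue_le_one_iff (minpoly.monic hy)]
  constructor
  · intro h
    have hl : minpoly ℚ_[p] y ∈ Polynomial.lifts (algebraMap ℤ_[p] ℚ_[p]) := by
      rw [Polynomial.lifts_iff_coeff_lifts]
      exact fun n => ⟨⟨_, h n⟩, rfl⟩
    obtain ⟨q, hq, -, hqm⟩ := Polynomial.lifts_and_natDegree_eq_and_monic hl (minpoly.monic hy)
    refine ⟨q, hqm, ?_⟩
    rw [← Polynomial.aeval_def, ← Polynomial.aeval_map_algebraMap ℚ_[p], hq, minpoly.aeval]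
  · intro h n
    rw [minpoly.isIntegrallyClosed_eq_field_fractions' ℚ_[p] h, Polynomial.coeff_map]
    exact PadicInt.norm_le_one _

theorem PadicAlgCl.norm_le_one_iff_isIntegral (z : PadicAlgCl p) :
    ‖z‖ ≤ 1 ↔ IsIntegral ℤ_[p] z :=
  spectralNorm_le_one_iff_isIntegral z

theorem PadicAlgCl.norm_algebraMap_padicInt (a : ℤ_[p]) :
    ‖algebraMap ℤ_[p] (PadicAlgCl p) a‖ = ‖a‖ := by
  rw [IsScalarTower.algebraMap_apply ℤ_[p] ℚ_[p] (PadicAlgCl p), norm_algebraMap']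
  rfl

/-- The entries are integral, so the adjugate can be computed over the ring of integral elements. -/
theorem PadicAlgCl.norm_adjugate_le_one {n : Type*} [Fintype n] [DecidableEq n]
    (B : Matrix n n (PadicAlgCl p)) (hB : ∀ i j, ‖B i j‖ ≤ 1) (i j : n) :
    ‖B.adjugate i j‖ ≤ 1 := by
  let φ := algebraMap (integralClosure ℤ_[p] (PadicAlgCl p)) (PadicAlgCl p)
  let B' : Matrix n n (integralClosure ℤ_[p] (PadicAlgCl p)) :=
    Matrix.of fun i j => ⟨B i j, (PadicAlgCl.norm_le_one_iff_isIntegral _).1 (hB i j)⟩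
  have h : B = φ.mapMatrix B' := rfl
  rw [h, ← RingHom.map_adjugate]
  exact (PadicAlgCl.norm_le_one_iff_isIntegral _).2 (B'.adjugate i j).2

theorem PadicAlgCl.norm_det_le_one {n : Type*} [Fintype n] [DecidableEq n]
    (B : Matrix n n (PadicAlgCl p)) (hB : ∀ i j, ‖B i j‖ ≤ 1) : ‖B.det‖ ≤ 1 := by
  let φ := algebraMap (integralClosure ℤ_[p] (PadicAlgCl p)) (PadicAlgCl p)
  let B' : Matrix n n (integralClosure ℤ_[p] (PadicAlgCl p)) :=
    Matrix.of fun i j => ⟨B i j, (PadicAlgCl.norm_le_one_iff_isIntegral _).1 (hB i j)⟩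
  have h : B = φ.mapMatrix B' := rfl
  rw [h, ← RingHom.map_det]
  exact (PadicAlgCl.norm_le_one_iff_isIntegral _).2 (B'.det).2

end IntegralElements

/-! ### Vandermonde determinant and discriminant -/

section RootDifferences

/-- The product of all differences of distinct members of a finite family. -/
def rootDifferences {F : Type*} [CommRing F] {r : ℕ} (l : Fin r → F) : F :=
  ∏ i, ∏ j ∈ Finset.univ.erase i, (l i - l j)

theorem norm_det_vandermonde_sq {F : Type*} [NormedField F] {r : ℕ} (l : Fin r → F) :
    ‖(Matrix.vandermonde l).det‖ ^ 2 = ‖rootDifferences l‖ := by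
  have h1 : ∀ i : Fin r, Finset.univ.erase i = Finset.Ioi i ∪ Finset.Iio i := by
    intro i
    ext j
    simp only [Finset.mem_erase, Finset.mem_univ, Finset.mem_union, Finset.mem_Ioi, Finset.mem_Iio]
    grind
  have h2 : ∀ i : Fin r, Disjoint (Finset.Ioi i) (Finset.Iio i) := by
    intro i
    rw [Finset.disjoint_left]
    intro j hj hj'
    simp only [Finset.mem_Ioi, Finset.mem_Iio] at hj hj'
    exact absurd (hj.trans hj') (lt_irrefl _)
  have h3 : ∏ i : Fin r, ∏ j ∈ Finset.Iio i, ‖l i - l j‖ =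
      ∏ i : Fin r, ∏ j ∈ Finset.Ioi i, ‖l j - l i‖ :=
    Finset.prod_comm' (by simp)
  simp only [rootDifferences, Matrix.det_vandermonde, norm_prod]
  simp_rw [h1, Finset.prod_union (h2 _), Finset.prod_mul_distrib, h3, sq]
  congr 1
  simp_rw [norm_sub_rev]

theorem rootDifferences_ne_zero {F : Type*} [Field F] {r : ℕ} {l : Fin r → F}
    (hl : Function.Injective l) : rootDifferences l ≠ 0 :=
  Finset.prod_ne_zero_iff.2 fun _ _ => Finset.prod_ne_zero_iff.2 fun _ hj =>
    sub_ne_zero.2 fun h => (Finset.mem_erase.1 hj).1 (hl h).symm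

end RootDifferences

/-! ### Simultaneous diagonalization by the embeddings -/

section Diagonalization

variable {p : ℕ} [Fact p.Prime] {E : Type*} [CommRing E] [Algebra ℚ_[p] E] {r : ℕ}

/-- The matrix of the values of a family of embeddings on a basis. -/
def embMatrix (ev : Fin r → E →ₐ[ℚ_[p]] PadicAlgCl p) (V : Module.Basis (Fin r) ℚ_[p] E) :
    Matrix (Fin r) (Fin r) (PadicAlgCl p) :=
  Matrix.of fun i j => ev i (V j)

variable (ev : Fin r → E →ₐ[ℚ_[p]] PadicAlgCl p) (V : Module.Basis (Fin r) ℚ_[p] E)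

theorem embMatrix_mulVec (y : E) :
    (embMatrix ev V).mulVec (fun j => algebraMap ℚ_[p] (PadicAlgCl p) (V.repr y j)) =
      fun i => ev i y := by
  ext i
  conv_rhs => rw [← V.sum_repr y]
  simp [embMatrix, Matrix.mulVec, dotProduct, Algebra.smul_def, mul_comm]

theorem embMatrix_mul_leftMulMatrix (y : E) :
    embMatrix ev V * (Algebra.leftMulMatrix V y).map (algebraMap ℚ_[p] (PadicAlgCl p)) =
      Matrix.diagonal (fun i => ev i y) * embMatrix ev V := by
  ext i j
  rw [Matrix.diagonal_mul]
  have h := congrFun (embMatrix_mulVec ev V (y * V j)) i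
  simp only [map_mul] at h
  rw [embMatrix, Matrix.of_apply, ← h]
  simp [Matrix.mul_apply, Matrix.mulVec, dotProduct, Algebra.leftMulMatrix_eq_repr_mul, embMatrix]

/-- A relation between the rows is a linear relation between the embeddings on a basis, hence on all
of `E`; Dedekind's independence of characters excludes it. -/
theorem embMatrix_det_ne_zero (hev : Function.Injective ev) : (embMatrix ev V).det ≠ 0 := by
  intro h
  obtain ⟨c, hc, hc0⟩ := Matrix.exists_vecMul_eq_zero_iff.2 h
  apply hc
  have hli := (linearIndependent_monoidHom E (PadicAlgCl p)).comp
    (fun i => (ev i : E →* PadicAlgCl p)) (fun i j hij => hev (by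
      ext y; exact DFunLike.congr_fun hij y))
  rw [Fintype.linearIndependent_iff] at hli
  funext i
  refine hli c ?_ i
  have hlin : ∑ i, c i • (ev i).toLinearMap = 0 := by
    refine V.ext fun j => ?_
    have := congrFun hc0 j
    simpa [Matrix.vecMul, dotProduct, embMatrix] using this
  funext y
  have := LinearMap.congr_fun hlin y
  simpa using this

theorem embMatrix_isUnit_det (hev : Function.Injective ev) : IsUnit (embMatrix ev V).det :=
  isUnit_iff_ne_zero.2 (embMatrix_det_ne_zero ev V hev)

include V in
theorem algebraMap_norm_eq_prod (hev : Function.Injective ev) (y : E) :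
    algebraMap ℚ_[p] (PadicAlgCl p) (Algebra.norm ℚ_[p] y) = ∏ i, ev i y := by
  have h := congrArg Matrix.det (embMatrix_mul_leftMulMatrix ev V y)
  rw [Matrix.det_mul, Matrix.det_mul, Matrix.det_diagonal, mul_comm] at h
  have h2 := mul_right_cancel₀ (embMatrix_det_ne_zero ev V hev) h
  rw [← h2, Algebra.norm_eq_matrix_det V, RingHom.map_det]
  rfl

include V in
theorem eq_of_forall_emb_eq (hev : Function.Injective ev) {y z : E} (h : ∀ i, ev i y = ev i z) :
    y = z := by
  have h1 : (embMatrix ev V).mulVec (fun j => algebraMap ℚ_[p] (PadicAlgCl p) (V.repr y j)) =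
      (embMatrix ev V).mulVec (fun j => algebraMap ℚ_[p] (PadicAlgCl p) (V.repr z j)) := by
    rw [embMatrix_mulVec, embMatrix_mulVec]; exact funext h
  have h2 := Matrix.mulVec_injective_of_isUnit
    ((Matrix.isUnit_iff_isUnit_det _).2 (embMatrix_isUnit_det ev V hev)) h1
  refine V.ext_elem fun j => ?_
  exact (algebraMap ℚ_[p] (PadicAlgCl p)).injective (congrFun h2 j)

include V in
-- Together the embeddings inject `E` into a power of the algebraic closure, where integrality is
-- checked coordinatewise.
theorem isIntegral_iff_forall_norm_emb_le_one [Algebra ℤ_[p] E] [IsScalarTower ℤ_[p] ℚ_[p] E]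
    (hev : Function.Injective ev) (y : E) :
    IsIntegral ℤ_[p] y ↔ ∀ i, ‖ev i y‖ ≤ 1 := by
  simp_rw [PadicAlgCl.norm_le_one_iff_isIntegral]
  constructor
  · exact fun h i => h.map ((ev i).restrictScalars ℤ_[p])
  · intro h
    let Φ : E →ₐ[ℤ_[p]] (Fin r → PadicAlgCl p) :=
      AlgHom.pi fun i => (ev i).restrictScalars ℤ_[p]
    have hΦ : Function.Injective Φ := fun a b hab =>
      eq_of_forall_emb_eq ev V hev fun i => congrFun hab i
    rw [← isIntegral_algHom_iff Φ hΦ]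
    exact isIntegral_pi fun i => h i

end Diagonalization

/-! ### The order generated by `x` -/

section PowerLattice

theorem Polynomial.aeval_eq_sum_fin {R S : Type*} [CommRing R] [CommRing S] [Algebra R S] {r : ℕ}
    {f : R[X]} (hf : f.degree < (r : WithBot ℕ)) (y : S) :
    aeval y f = ∑ j : Fin r, algebraMap R S (f.coeff j) * y ^ (j : ℕ) := by
  rw [← Finset.sum_range fun j => algebraMap R S (f.coeff j) * y ^ j]
  rcases Nat.eq_zero_or_pos r with rfl | hr
  · simp [degree_eq_bot.1 (Nat.WithBot.lt_zero_iff.1 hf)]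
  · rw [aeval_eq_sum_range' (by
      by_cases h0 : f = 0
      · simpa [h0] using hr
      · exact (natDegree_lt_iff_degree_lt h0).2 hf)]
    simp_rw [Algebra.smul_def]

variable {p : ℕ} [Fact p.Prime] {E : Type*} [CommRing E] [Algebra ℚ_[p] E] [Algebra ℤ_[p] E]
  [IsScalarTower ℤ_[p] ℚ_[p] E] {r : ℕ}

theorem aeval_eq_zero_iff_aeval_matrix {V : Module.Basis (Fin r) ℚ_[p] E} {x : E}
    {A : Matrix (Fin r) (Fin r) ℤ_[p]}
    (hA : A.map (algebraMap ℤ_[p] ℚ_[p]) = Algebra.leftMulMatrix V x) (f : ℤ_[p][X]) :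
    (aeval A f).map (algebraMap ℤ_[p] ℚ_[p]) = Algebra.leftMulMatrix V (aeval x f) := by
  have h1 : (aeval A f).map (algebraMap ℤ_[p] ℚ_[p]) =
      aeval (A.map (algebraMap ℤ_[p] ℚ_[p])) f :=
    (aeval_algHom_apply (Algebra.ofId ℤ_[p] ℚ_[p]).mapMatrix A f).symm
  rw [h1, hA]
  exact aeval_algHom_apply ((Algebra.leftMulMatrix V).restrictScalars ℤ_[p]) x f

/-- An integral polynomial in an element with integral matrix can be reduced to degree less than
the size of the matrix. -/
theorem exists_degree_lt_aeval_eq {V : Module.Basis (Fin r) ℚ_[p] E} {x : E}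
    {A : Matrix (Fin r) (Fin r) ℤ_[p]}
    (hA : A.map (algebraMap ℤ_[p] ℚ_[p]) = Algebra.leftMulMatrix V x) (g : ℤ_[p][X]) :
    ∃ f : ℤ_[p][X], f.degree < (r : WithBot ℕ) ∧ aeval x f = aeval x g := by
  -- Cayley–Hamilton: division by this monic integral polynomial of degree `r` does not change the
  -- value at `x`.
  have h0 : aeval x A.charpoly = 0 := by
    apply Algebra.leftMulMatrix_injective V
    rw [← aeval_eq_zero_iff_aeval_matrix hA, Matrix.aeval_self_charpoly, map_zero]
    ext; simp
  refine ⟨g %ₘ A.charpoly, ?_, ?_⟩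
  · have := degree_modByMonic_lt g A.charpoly_monic
    rwa [Matrix.charpoly_degree_eq_dim, Fintype.card_fin] at this
  · conv_rhs => rw [← modByMonic_add_div g A.charpoly]
    simp [h0]

variable {ev : Fin r → E →ₐ[ℚ_[p]] PadicAlgCl p}

omit [Algebra ℤ_[p] E] [IsScalarTower ℤ_[p] ℚ_[p] E] in
/-- The powers of an element with distinct conjugates form a basis. -/
theorem exists_powers_basis (V : Module.Basis (Fin r) ℚ_[p] E) (x : E)
    (hx : Function.Injective fun i => ev i x) :
    ∃ B : Module.Basis (Fin r) ℚ_[p] E, ∀ j, B j = x ^ (j : ℕ) := by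
  have hli : LinearIndependent ℚ_[p] fun j : Fin r => x ^ (j : ℕ) := by
    rw [Fintype.linearIndependent_iff]
    intro c hc
    have h1 : (Matrix.vandermonde fun i => ev i x).mulVec
        (fun j => algebraMap ℚ_[p] (PadicAlgCl p) (c j)) = 0 := by
      funext i
      have := congrArg (ev i) hc
      simpa [Matrix.mulVec, dotProduct, Matrix.vandermonde_apply, Algebra.smul_def, mul_comm]
        using this
    have h2 := Matrix.eq_zero_of_mulVec_eq_zero (Matrix.det_vandermonde_ne_zero_iff.2 hx) h1
    intro j
    exact (map_eq_zero _).1 (congrFun h2 j)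
  have hcard : Fintype.card (Fin r) = Module.finrank ℚ_[p] E :=
    (Module.finrank_eq_card_basis V).symm
  rcases isEmpty_or_nonempty (Fin r) with h | h
  · exact ⟨V, fun j => isEmptyElim j⟩
  · exact ⟨basisOfLinearIndependentOfCardEqFinrank hli hcard, fun j => by simp⟩

/-- An element whose conjugates are divisible by the discriminant of `x` is an integral
polynomial in `x`. -/
theorem exists_aeval_eq_of_norm_le (V : Module.Basis (Fin r) ℚ_[p] E) {x : E}
    (hx : Function.Injective fun i => ev i x) (hint : ∀ i, ‖ev i x‖ ≤ 1) {y : E}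
    (hy : ∀ i, ‖ev i y‖ ≤ ‖rootDifferences fun i => ev i x‖) :
    ∃ g : ℤ_[p][X], aeval x g = y := by
  obtain ⟨B, hB⟩ := exists_powers_basis V x hx
  set W := Matrix.vandermonde fun i => ev i x with hW
  have hWe : embMatrix ev B = W := by
    ext i j; simp [embMatrix, hB, hW, Matrix.vandermonde_apply]
  have hW1 : ∀ i j, ‖W i j‖ ≤ 1 := fun i j => by
    rw [hW, Matrix.vandermonde_apply, norm_pow]
    exact pow_le_one₀ (norm_nonneg _) (hint i)
  have hdet0 : W.det ≠ 0 := Matrix.det_vandermonde_ne_zero_iff.2 hx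
  have hdet1 : ‖W.det‖ ≤ 1 := PadicAlgCl.norm_det_le_one W hW1
  -- Cramer's rule: `det W` times the coefficient vector of `y` is the adjugate applied to the
  -- conjugates of `y`. As the discriminant has norm `‖det W‖²`, each coefficient has norm at most
  -- `‖det W‖ ≤ 1`.
  have hmul := congrArg W.adjugate.mulVec (hWe ▸ embMatrix_mulVec ev B y)
  rw [Matrix.mulVec_mulVec, Matrix.adjugate_mul, Matrix.smul_mulVec, Matrix.one_mulVec] at hmul
  have hcoef : ∀ j, ‖B.repr y j‖ ≤ 1 := by
    intro j
    have h1 := congrArg norm (congrFun hmul j)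
    rw [Pi.smul_apply, norm_smul, norm_algebraMap'] at h1
    have h2 : ‖W.adjugate.mulVec (fun i => ev i y) j‖ ≤ ‖W.det‖ ^ 2 := by
      rw [norm_det_vandermonde_sq]
      rw [Matrix.mulVec, dotProduct]
      refine IsUltrametricDist.norm_sum_le_of_forall_le_of_nonneg ?_ fun i _ => ?_
      · exact norm_nonneg _
      rw [norm_mul]
      exact (mul_le_of_le_one_left (norm_nonneg _)
        (PadicAlgCl.norm_adjugate_le_one W hW1 j i)).trans (hy i)
    have h3 : 0 < ‖W.det‖ := norm_pos_iff.2 hdet0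
    have h4 : ‖W.det‖ * ‖B.repr y j‖ ≤ ‖W.det‖ * ‖W.det‖ := by rw [h1, ← sq]; exact h2
    exact (le_of_mul_le_mul_left h4 h3).trans hdet1
  choose a ha using fun j => show ∃ a : ℤ_[p], algebraMap ℤ_[p] ℚ_[p] a = B.repr y j from
    ⟨⟨_, hcoef j⟩, rfl⟩
  refine ⟨∑ j : Fin r, C (a j) * X ^ (j : ℕ), ?_⟩
  conv_rhs => rw [← B.sum_repr y]
  simp only [map_sum, map_mul, aeval_C, map_pow, aeval_X, hB, Algebra.smul_def, ← ha,
    IsScalarTower.algebraMap_apply ℤ_[p] ℚ_[p] E]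

/-- In an ultrametric field, moving two points by less than their distance leaves the distance
unchanged. -/
theorem norm_sub_eq_of_norm_sub_lt {F : Type*} [NormedField F] [IsUltrametricDist F]
    {a b a' b' : F} (ha : ‖a' - a‖ < ‖a - b‖) (hb : ‖b' - b‖ < ‖a - b‖) :
    ‖a' - b'‖ = ‖a - b‖ := by
  have h1 : ‖(a' - a) - (b' - b)‖ < ‖a - b‖ := by
    rw [sub_eq_add_neg]
    exact (IsUltrametricDist.norm_add_le_max _ _).trans_lt (max_lt ha (by rwa [norm_neg]))
  have h2 : a' - b' = (a - b) + ((a' - a) - (b' - b)) := by ring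
  rw [h2, IsUltrametricDist.norm_add_eq_max_of_norm_ne_norm h1.ne', max_eq_left h1.le]

/-- An integral polynomial in `x` that is close to `x` generates the same order. -/
theorem exists_aeval_aeval_eq_self {V : Module.Basis (Fin r) ℚ_[p] E} {x : E}
    {A : Matrix (Fin r) (Fin r) ℤ_[p]}
    (hA : A.map (algebraMap ℤ_[p] ℚ_[p]) = Algebra.leftMulMatrix V x)
    (hx : Function.Injective fun i => ev i x) {f : ℤ_[p][X]}
    (hf : ∀ i j, i ≠ j → ‖ev i (aeval x f) - ev i x‖ < ‖ev i x - ev j x‖) :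
    ∃ h : ℤ_[p][X], aeval (aeval x f) h = x := by
  choose g hg hgx using fun k : Fin r => exists_degree_lt_aeval_eq hA (f ^ (k : ℕ))
  -- `X` has degree below `r` only if `r ≥ 2`, so `x` itself has to be reduced as well.
  obtain ⟨d, hd, hdx⟩ := exists_degree_lt_aeval_eq hA X
  let c : Matrix (Fin r) (Fin r) ℤ_[p] := Matrix.of fun j k => (g k).coeff j
  have hpow : ∀ k : Fin r, aeval x f ^ (k : ℕ) =
      ∑ j : Fin r, algebraMap ℤ_[p] E (c j k) * x ^ (j : ℕ) := by
    intro k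
    rw [← map_pow, ← hgx k, Polynomial.aeval_eq_sum_fin (hg k)]
    rfl
  have hmul : (Matrix.vandermonde fun i => ev i (aeval x f)) =
      (Matrix.vandermonde fun i => ev i x) *
        (algebraMap ℤ_[p] (PadicAlgCl p)).mapMatrix c := by
    ext i k
    have h1 := congrArg ((ev i).restrictScalars ℤ_[p]) (hpow k)
    rw [map_pow, map_sum] at h1
    simp only [AlgHom.coe_restrictScalars', map_mul, map_pow] at h1
    rw [Matrix.vandermonde_apply, h1, Matrix.mul_apply]
    refine Finset.sum_congr rfl fun j _ => ?_
    rw [mul_comm, Matrix.vandermonde_apply]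
    congr 1
    exact ((ev i).restrictScalars ℤ_[p]).commutes _
  -- The matrix `c` writes the powers of `f(x)` in powers of `x`, and its determinant is the
  -- quotient of two Vandermonde determinants. The closeness of `f(x)` to `x` makes their norms
  -- equal, so `c` is invertible over `ℤ_p` and `x` is recovered from the powers of `f(x)`.
  have hdet : ‖(Matrix.vandermonde fun i => ev i (aeval x f)).det‖ =
      ‖(Matrix.vandermonde fun i => ev i x).det‖ := by
    simp only [Matrix.det_vandermonde, norm_prod]
    refine Finset.prod_congr rfl fun i _ => Finset.prod_congr rfl fun j hj => ?_
    have hij : i ≠ j := (Finset.mem_Ioi.1 hj).ne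
    exact norm_sub_eq_of_norm_sub_lt (hf j i hij.symm)
      (by rw [norm_sub_rev (ev j x)]; exact hf i j hij)
  have hunit : IsUnit c.det := by
    rw [PadicInt.isUnit_iff, ← PadicAlgCl.norm_algebraMap_padicInt, RingHom.map_det]
    rw [hmul, Matrix.det_mul, norm_mul] at hdet
    exact mul_eq_left₀ (norm_ne_zero_iff.2 (Matrix.det_vandermonde_ne_zero_iff.2 hx)) |>.1 hdet
  let a : Fin r → ℤ_[p] := c⁻¹.mulVec fun j => d.coeff j
  have ha : c.mulVec a = fun j : Fin r => d.coeff j := by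
    simp only [a, Matrix.mulVec_mulVec, Matrix.mul_nonsing_inv c hunit, Matrix.one_mulVec]
  refine ⟨∑ k : Fin r, C (a k) * X ^ (k : ℕ), ?_⟩
  simp only [map_sum, map_mul, aeval_C, map_pow, aeval_X]
  rw [aeval_X, Polynomial.aeval_eq_sum_fin hd] at hdx
  refine Eq.trans ?_ hdx
  simp_rw [hpow, Finset.mul_sum]
  rw [Finset.sum_comm]
  refine Finset.sum_congr rfl fun j _ => ?_
  rw [← congrFun ha j, Matrix.mulVec, dotProduct, map_sum, Finset.sum_mul]
  refine Finset.sum_congr rfl fun k _ => ?_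
  rw [map_mul]; ring

end PowerLattice

/-! ### The commutator map and its eigenvalues -/

section Commutator

/-- The map `T ↦ T * A - A * T` on matrices. -/
def Matrix.commMap {R n : Type*} [CommRing R] [Fintype n] (A : Matrix n n R) :
    Matrix n n R →ₗ[R] Matrix n n R :=
  LinearMap.mulRight R A - LinearMap.mulLeft R A

variable {R F n : Type*} [CommRing R] [Field F] [Fintype n]

theorem Matrix.commMap_apply (A T : Matrix n n R) : A.commMap T = T * A - A * T := by
  simp [Matrix.commMap]

theorem Matrix.mem_ker_commMap (A T : Matrix n n R) :
    T ∈ LinearMap.ker A.commMap ↔ T * A = A * T := by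
  rw [LinearMap.mem_ker, Matrix.commMap_apply, sub_eq_zero]

theorem Matrix.map_commMap (φ : R →+* F) (A T : Matrix n n R) :
    (A.commMap T).map φ = (A.map φ).commMap (T.map φ) := by
  simp only [Matrix.commMap_apply]
  rw [Matrix.map_sub _ (map_sub φ), Matrix.map_mul, Matrix.map_mul]

variable [DecidableEq n]

theorem Matrix.conj_commMap_apply {B W : Matrix n n F} {l : n → F} (hW : IsUnit W.det)
    (h : W * B = Matrix.diagonal l * W) (T : Matrix n n F) (i j : n) :
    (W * B.commMap T * W⁻¹) i j = (l j - l i) * (W * T * W⁻¹) i j := by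
  have h1 : B * W⁻¹ = W⁻¹ * Matrix.diagonal l := by
    have : W⁻¹ * (W * B) * W⁻¹ = W⁻¹ * (Matrix.diagonal l * W) * W⁻¹ := by rw [h]
    rwa [← Matrix.mul_assoc, Matrix.nonsing_inv_mul _ hW, Matrix.one_mul, Matrix.mul_assoc,
      Matrix.mul_assoc, Matrix.mul_nonsing_inv _ hW, Matrix.mul_one] at this
  have h2 : W * B.commMap T * W⁻¹ =
      (W * T * W⁻¹) * Matrix.diagonal l - Matrix.diagonal l * (W * T * W⁻¹) := by
    rw [Matrix.commMap_apply, Matrix.mul_sub, Matrix.sub_mul]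
    congr 1
    · simp only [Matrix.mul_assoc, h1]
    · simp only [← Matrix.mul_assoc, h]
  rw [h2, Matrix.sub_apply, Matrix.mul_diagonal, Matrix.diagonal_mul]
  ring

/-- After conjugation by `W` each matrix unit `(i, j)` is an eigenvector with eigenvalue `l j - l
i`. -/
theorem Matrix.charpoly_commMap {B W : Matrix n n F} {l : n → F} (hW : IsUnit W.det)
    (h : W * B = Matrix.diagonal l * W) :
    B.commMap.charpoly = ∏ i, ∏ j, (X - C (l j - l i)) := by
  let e : Matrix n n F ≃ₗ[F] Matrix n n F :=
    { toFun := fun T => W * T * W⁻¹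
      map_add' := fun S T => by rw [Matrix.mul_add, Matrix.add_mul]
      map_smul' := fun c T => by simp
      invFun := fun T => W⁻¹ * T * W
      left_inv := fun T => by
        change W⁻¹ * (W * T * W⁻¹) * W = T
        rw [Matrix.mul_assoc W, ← Matrix.mul_assoc W⁻¹, Matrix.nonsing_inv_mul _ hW,
          Matrix.one_mul, Matrix.mul_assoc, Matrix.nonsing_inv_mul _ hW, Matrix.mul_one]
      right_inv := fun T => by
        change W * (W⁻¹ * T * W) * W⁻¹ = T
        rw [Matrix.mul_assoc W⁻¹, ← Matrix.mul_assoc W, Matrix.mul_nonsing_inv _ hW,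
          Matrix.one_mul, Matrix.mul_assoc, Matrix.mul_nonsing_inv _ hW, Matrix.mul_one] }
  rw [← LinearEquiv.charpoly_conj e, ← LinearMap.charpoly_toMatrix _ (Matrix.stdBasis F n n),
    ← Fintype.prod_prod_type' fun i j => (X - C (l j - l i)), ← Matrix.charpoly_diagonal]
  congr 1
  ext ⟨i, j⟩ ⟨k, m⟩
  have h1 : ∀ S : Matrix n n F, ∀ i j, (e.conj B.commMap S) i j = (l j - l i) * S i j := by
    intro S i j
    rw [LinearEquiv.conj_apply_apply]
    change (W * B.commMap (e.symm S) * W⁻¹) i j = _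
    rw [Matrix.conj_commMap_apply hW h]
    congr 1
    exact congrFun (congrFun (e.apply_symm_apply S) i) j
  rw [LinearMap.toMatrix_apply, Matrix.stdBasis_eq_single]
  have h2 : ∀ S : Matrix n n F, (Matrix.stdBasis F n n).repr S (i, j) = S i j := by
    intro S
    simp [Matrix.stdBasis]
  rw [h2, h1, Matrix.diagonal_apply, Matrix.single_apply]
  by_cases hk : k = i ∧ m = j
  · obtain ⟨rfl, rfl⟩ := hk; simp
  · have : (i, j) ≠ (k, m) := fun h => hk (by simpa [eq_comm] using h)
    simp [hk, this]

theorem Matrix.map_charpoly_commMap (φ : R →+* F) (A : Matrix n n R) :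
    A.commMap.charpoly.map φ = (A.map φ).commMap.charpoly := by
  rw [← LinearMap.charpoly_toMatrix A.commMap (Matrix.stdBasis R n n),
    ← LinearMap.charpoly_toMatrix (A.map φ).commMap (Matrix.stdBasis F n n), ← Matrix.charpoly_map]
  congr 1
  ext ⟨i, j⟩ ⟨k, m⟩
  have h2 : ∀ S : Matrix n n F, (Matrix.stdBasis F n n).repr S (i, j) = S i j := by
    intro S
    simp [Matrix.stdBasis]
  have h3 : ∀ S : Matrix n n R, (Matrix.stdBasis R n n).repr S (i, j) = S i j := by
    intro S
    simp [Matrix.stdBasis]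
  rw [Matrix.map_apply, LinearMap.toMatrix_apply, LinearMap.toMatrix_apply,
    Matrix.stdBasis_eq_single, Matrix.stdBasis_eq_single, h2, h3]
  have h4 : (Matrix.single k m (1 : F)) = (Matrix.single k m (1 : R)).map φ := by
    ext a b; simp [Matrix.single_apply, apply_ite φ]
  rw [h4, ← Matrix.map_commMap]
  rfl

/-- A diagonalizable matrix has semisimple commutator map. -/
theorem Matrix.commMap_eq_zero_of_commMap_commMap {φ : R →+* F} (hφ : Function.Injective φ)
    {A : Matrix n n R} {W : Matrix n n F} {l : n → F} (hW : IsUnit W.det)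
    (h : W * A.map φ = Matrix.diagonal l * W) {T : Matrix n n R}
    (hT : A.commMap (A.commMap T) = 0) : A.commMap T = 0 := by
  have hinj : ∀ S : Matrix n n F, W * S * W⁻¹ = 0 → S = 0 := by
    intro S hS
    have h1 : W⁻¹ * (W * S * W⁻¹) * W = 0 := by rw [hS]; simp
    rwa [Matrix.mul_assoc W, ← Matrix.mul_assoc W⁻¹, Matrix.nonsing_inv_mul _ hW,
      Matrix.one_mul, Matrix.mul_assoc, Matrix.nonsing_inv_mul _ hW, Matrix.mul_one] at h1
  apply Matrix.map_injective hφ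
  beta_reduce
  rw [Matrix.map_zero _ (map_zero φ), Matrix.map_commMap]
  apply hinj
  ext i j
  have h1 : (W * (A.map φ).commMap ((A.map φ).commMap (T.map φ)) * W⁻¹) i j = 0 := by
    rw [← Matrix.map_commMap, ← Matrix.map_commMap, hT, Matrix.map_zero _ (map_zero φ)]
    simp
  rw [Matrix.conj_commMap_apply hW h] at h1
  rw [Matrix.zero_apply]
  rcases mul_eq_zero.1 h1 with h2 | h2
  · rw [Matrix.conj_commMap_apply hW h, h2, zero_mul]
  · exact h2

theorem Matrix.disjoint_ker_range_commMap {φ : R →+* F} (hφ : Function.Injective φ)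
    {A : Matrix n n R} {W : Matrix n n F} {l : n → F} (hW : IsUnit W.det)
    (h : W * A.map φ = Matrix.diagonal l * W) :
    Disjoint (LinearMap.ker A.commMap) (LinearMap.range A.commMap) := by
  rw [Submodule.disjoint_def]
  rintro _ hS ⟨T, rfl⟩
  exact Matrix.commMap_eq_zero_of_commMap_commMap hφ hW h hS

end Commutator

/-! ### Characteristic polynomial modulo the kernel -/

section CharpolyQuotient

variable {R M : Type*} [CommRing R] [IsDomain R] [IsPrincipalIdealRing R] [AddCommGroup M]
  [Module R M] [Module.Free R M] [Module.Finite R M]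

/-- The quotient is isomorphic to the range, a submodule of a free module over a principal ideal
domain. Without freeness the determinant on the quotient could be the default value `1`. -/
instance LinearMap.free_quotient_ker {N : Type*} [AddCommGroup N] [Module R N] [Module.Free R N]
    [Module.Finite R N] (f : M →ₗ[R] N) : Module.Free R (M ⧸ LinearMap.ker f) :=
  Module.Free.of_equiv f.quotKerEquivRange.symm

omit [IsDomain R] [IsPrincipalIdealRing R] [Module.Free R M] [Module.Finite R M] in
theorem LinearMap.ker_le_comap_ker_self (f : M →ₗ[R] M) :
    LinearMap.ker f ≤ (LinearMap.ker f).comap f := by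
  intro y hy
  rw [Submodule.mem_comap, LinearMap.mem_ker.1 hy]
  exact Submodule.zero_mem _

/-- The endomorphism induced on the quotient by the kernel. -/
def LinearMap.quotKerEnd (f : M →ₗ[R] M) : (M ⧸ LinearMap.ker f) →ₗ[R] (M ⧸ LinearMap.ker f) :=
  (LinearMap.ker f).mapQ (LinearMap.ker f) f f.ker_le_comap_ker_self

/-- For each `t`, `det (t - f)` is multiplicative along the invariant submodule `ker f`, on which `t
- f` is the scalar `t`; infinitely many `t` determine the polynomial. -/
theorem LinearMap.charpoly_eq_X_pow_mul_charpoly_quotKerEnd [Infinite R] (f : M →ₗ[R] M) :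
    f.charpoly = X ^ Module.finrank R (LinearMap.ker f) * f.quotKerEnd.charpoly := by
  refine Polynomial.funext fun t => ?_
  have hle : LinearMap.ker f ≤ (LinearMap.ker f).comap (algebraMap R (M →ₗ[R] M) t - f) := by
    intro y hy
    rw [Submodule.mem_comap, LinearMap.sub_apply, LinearMap.mem_ker.1 hy, sub_zero]
    exact Submodule.smul_mem _ t hy
  rw [eval_mul, eval_pow, eval_X, LinearMap.eval_charpoly, LinearMap.eval_charpoly,
    LinearMap.det_eq_det_mul_det (LinearMap.ker f) _ hle]
  congr 1
  · have : (algebraMap R (M →ₗ[R] M) t - f).restrict (p := LinearMap.ker f)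
        (q := LinearMap.ker f) (fun y hy => hle hy) = t • LinearMap.id := by
      ext y
      have hy : f y = 0 := y.2
      simp [LinearMap.restrict_apply, hy, Module.algebraMap_end_apply]
    refine (congrArg LinearMap.det this).trans ?_
    rw [LinearMap.det_smul, LinearMap.det_id, mul_one]
  · congr 1
    ext y
    simp [LinearMap.quotKerEnd, Module.algebraMap_end_apply]

theorem LinearMap.det_quotKerEnd_ne_zero {f : M →ₗ[R] M}
    (hf : Disjoint (LinearMap.ker f) (LinearMap.range f)) : LinearMap.det f.quotKerEnd ≠ 0 := by
  intro h
  rw [LinearMap.det_eq_zero_iff_ker_ne_bot] at h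
  apply h
  rw [LinearMap.ker_eq_bot']
  intro q hq
  obtain ⟨y, rfl⟩ := Submodule.mkQ_surjective _ q
  have h1 : f y ∈ LinearMap.ker f := by
    rw [LinearMap.quotKerEnd, Submodule.mkQ_apply, Submodule.mapQ_apply,
      Submodule.Quotient.mk_eq_zero] at hq
    exact hq
  rw [Submodule.mkQ_apply, Submodule.Quotient.mk_eq_zero]
  exact (Submodule.disjoint_def.1 hf) _ h1 ⟨y, rfl⟩

end CharpolyQuotient

/-! ### Index of kernel plus scaled range of the commutator -/

section CommutatorIndex

variable {p : ℕ} [Fact p.Prime]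

/-- Modulo `ker f` the subgroup becomes the range of `c` times the induced endomorphism, so the
index is the inverse norm of that determinant. -/
theorem LinearMap.index_ker_sup_range_smul {M : Type*} [AddCommGroup M] [Module ℤ_[p] M]
    [Module.Free ℤ_[p] M] [Module.Finite ℤ_[p] M] {f : M →ₗ[ℤ_[p]] M}
    (hf : Disjoint (LinearMap.ker f) (LinearMap.range f)) {c : ℤ_[p]} (hc : c ≠ 0) :
    ((LinearMap.ker f ⊔ LinearMap.range (c • f)).toAddSubgroup.index : ℝ) =
      (‖c‖ ^ Module.finrank ℤ_[p] (M ⧸ LinearMap.ker f) * ‖LinearMap.det f.quotKerEnd‖)⁻¹ := by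
  have hle : LinearMap.ker f ≤ (LinearMap.ker f).comap (c • f) := by
    intro y hy
    rw [Submodule.mem_comap, LinearMap.smul_apply, LinearMap.mem_ker.1 hy, smul_zero]
    exact Submodule.zero_mem _
  have h1 : c • f.quotKerEnd = (LinearMap.ker f).mapQ (LinearMap.ker f) (c • f) hle := by
    ext y; simp [LinearMap.quotKerEnd]
  have h2 : LinearMap.det (c • f.quotKerEnd) ≠ 0 := by
    rw [LinearMap.det_smul]
    exact mul_ne_zero (pow_ne_zero _ hc) (LinearMap.det_quotKerEnd_ne_zero hf)
  have h3 := LinearMap.card_quotient_range _ h2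
  rw [LinearMap.det_smul, norm_mul, norm_pow] at h3
  rw [← h3]
  congr 1
  rw [h1, Submodule.range_mapQ]
  exact (Nat.card_congr (Submodule.quotientQuotientEquivQuotientSup (LinearMap.ker f)
    (LinearMap.range (c • f))).toEquiv).symm

theorem Polynomial.eq_of_mul_X_pow_eq {F : Type*} [Field F] {f g : F[X]} {k l : ℕ}
    (hf : f.coeff 0 ≠ 0) (hg : g.coeff 0 ≠ 0) (h : f * X ^ k = g * X ^ l) : k = l ∧ f = g := by
  have hf0 : f ≠ 0 := by rintro rfl; simp at hf
  have hg0 : g ≠ 0 := by rintro rfl; simp at hg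
  have h1 := congrArg natTrailingDegree h
  rw [natTrailingDegree_mul_X_pow hf0, natTrailingDegree_mul_X_pow hg0,
    natTrailingDegree_eq_zero.2 (Or.inr hf), natTrailingDegree_eq_zero.2 (Or.inr hg), zero_add,
    zero_add] at h1
  subst h1
  exact ⟨rfl, mul_right_cancel₀ (pow_ne_zero _ X_ne_zero) h⟩

variable {r : ℕ} {A : Matrix (Fin r) (Fin r) ℤ_[p]} {W : Matrix (Fin r) (Fin r) (PadicAlgCl p)}
  {l : Fin r → PadicAlgCl p}

/-- The characteristic polynomial of the commutator is a power of `X` times that of the induced map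
on the quotient, and also `X ^ r` times the product over `i ≠ j`. Both cofactors have nonzero
constant term, so powers and cofactors agree separately. -/
theorem finrank_ker_commMap_and_norm_det (hW : IsUnit W.det)
    (h : W * A.map (algebraMap ℤ_[p] (PadicAlgCl p)) = Matrix.diagonal l * W)
    (hl : Function.Injective l) :
    Module.finrank ℤ_[p] (LinearMap.ker A.commMap) = r ∧
      ‖LinearMap.det A.commMap.quotKerEnd‖ = ‖rootDifferences l‖ := by
  have hφ : Function.Injective (algebraMap ℤ_[p] (PadicAlgCl p)) := by
    rw [IsScalarTower.algebraMap_eq ℤ_[p] ℚ_[p] (PadicAlgCl p)]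
    exact (algebraMap ℚ_[p] (PadicAlgCl p)).injective.comp (IsFractionRing.injective _ _)
  have hdisj := Matrix.disjoint_ker_range_commMap hφ hW h
  have hdet := LinearMap.det_quotKerEnd_ne_zero hdisj
  set q := A.commMap.quotKerEnd.charpoly with hq
  set s : (PadicAlgCl p)[X] := ∏ i, ∏ j ∈ Finset.univ.erase i, (X - C (l j - l i)) with hs
  have hs0 : s.coeff 0 = rootDifferences l := by
    rw [coeff_zero_eq_eval_zero, hs, eval_prod, rootDifferences]
    refine Finset.prod_congr rfl fun i _ => ?_
    rw [eval_prod]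
    exact Finset.prod_congr rfl fun j _ => by simp
  have h1 : q.map (algebraMap ℤ_[p] (PadicAlgCl p)) *
      X ^ Module.finrank ℤ_[p] (LinearMap.ker A.commMap) = s * X ^ r := by
    have h2 := Matrix.map_charpoly_commMap (algebraMap ℤ_[p] (PadicAlgCl p)) A
    rw [LinearMap.charpoly_eq_X_pow_mul_charpoly_quotKerEnd, Matrix.charpoly_commMap hW h,
      Polynomial.map_mul, Polynomial.map_pow, map_X, mul_comm] at h2
    rw [h2, hs]
    have h3 : (X : (PadicAlgCl p)[X]) ^ r = ∏ i : Fin r, (X - C (l i - l i)) := by simp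
    rw [h3, ← Finset.prod_mul_distrib]
    exact Finset.prod_congr rfl fun i _ => (Finset.prod_erase_mul _ _ (Finset.mem_univ i)).symm
  have hq0 : ‖q.coeff 0‖ = ‖LinearMap.det A.commMap.quotKerEnd‖ := by
    rw [LinearMap.det_eq_sign_charpoly_coeff, norm_mul, norm_pow, norm_neg, norm_one, one_pow,
      one_mul]
  obtain ⟨hk, hqs⟩ := Polynomial.eq_of_mul_X_pow_eq (by
      rw [coeff_map]
      intro h0
      rw [(map_eq_zero_iff _ hφ).1 h0, norm_zero] at hq0
      exact hdet (norm_eq_zero.1 hq0.symm)) (by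
      rw [hs0]; exact rootDifferences_ne_zero hl) h1
  refine ⟨hk, ?_⟩
  rw [← hq0, ← hs0, ← hqs, coeff_map, PadicAlgCl.norm_algebraMap_padicInt]

theorem index_ker_sup_range_commMap (hW : IsUnit W.det)
    (h : W * A.map (algebraMap ℤ_[p] (PadicAlgCl p)) = Matrix.diagonal l * W)
    (hl : Function.Injective l) (N : ℕ) :
    ((LinearMap.ker A.commMap ⊔
      LinearMap.range ((p : ℤ_[p]) ^ N • A.commMap)).toAddSubgroup.index : ℝ) =
      (p : ℝ) ^ (N * (r * r - r)) * ‖rootDifferences l‖⁻¹ := by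
  have hφ : Function.Injective (algebraMap ℤ_[p] (PadicAlgCl p)) := by
    rw [IsScalarTower.algebraMap_eq ℤ_[p] ℚ_[p] (PadicAlgCl p)]
    exact (algebraMap ℚ_[p] (PadicAlgCl p)).injective.comp (IsFractionRing.injective _ _)
  obtain ⟨hk, hd⟩ := finrank_ker_commMap_and_norm_det hW h hl
  have hp : (p : ℤ_[p]) ^ N ≠ 0 := pow_ne_zero _ (NeZero.ne _)
  rw [LinearMap.index_ker_sup_range_smul (Matrix.disjoint_ker_range_commMap hφ hW h) hp, hd,
    mul_inv, norm_pow, PadicInt.norm_p]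
  congr 1
  have h2 := Submodule.finrank_quotient_add_finrank (LinearMap.ker A.commMap)
  rw [hk, Module.finrank_matrix] at h2
  simp only [Fintype.card_fin, Module.finrank_self, mul_one] at h2
  rw [show Module.finrank ℤ_[p] (Matrix (Fin r) (Fin r) ℤ_[p] ⧸ LinearMap.ker A.commMap) =
    r * r - r by omega, inv_pow, inv_pow, inv_inv, ← pow_mul]

end CommutatorIndex

/-! ### The multiplier order and the maximal order -/

section Orders

theorem Module.Basis.extendOfIsLattice_repr {R F W κ : Type*} [CommRing R] [Field F] [Algebra R F]
    [IsFractionRing R F] [AddCommGroup W] [Module F W] [Module R W] [IsScalarTower R F W]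
    [Finite κ] {O : Submodule R W} [Submodule.IsLattice F O] (b : Module.Basis κ R O) (z : O)
    (i : κ) : (b.extendOfIsLattice F).repr (z : W) i = algebraMap R F (b.repr z i) := by
  have := Fintype.ofFinite κ
  have h1 : (z : W) = ∑ i, algebraMap R F (b.repr z i) • b.extendOfIsLattice F i := by
    conv_lhs => rw [← b.sum_repr z]
    rw [Submodule.coe_sum]
    exact Finset.sum_congr rfl fun i _ => by
      rw [Module.Basis.extendOfIsLattice_apply, algebraMap_smul, Submodule.coe_smul]
  rw [h1, Module.Basis.repr_sum_self]

variable {p : ℕ} [Fact p.Prime] {E : Type*} [CommRing E] [Algebra ℚ_[p] E] [Algebra ℤ_[p] E]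
  [IsScalarTower ℤ_[p] ℚ_[p] E] {r : ℕ}

/-- The inclusion of the integral matrices. -/
def matrixCoe (p : ℕ) [Fact p.Prime] (r : ℕ) :
    Matrix (Fin r) (Fin r) ℤ_[p] →ₐ[ℤ_[p]] Matrix (Fin r) (Fin r) ℚ_[p] :=
  (Algebra.ofId ℤ_[p] ℚ_[p]).mapMatrix

theorem matrixCoe_apply (X : Matrix (Fin r) (Fin r) ℤ_[p]) :
    matrixCoe p r X = X.map (algebraMap ℤ_[p] ℚ_[p]) := rfl

theorem matrixCoe_injective : Function.Injective (matrixCoe p r) :=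
  Matrix.map_injective (IsFractionRing.injective ℤ_[p] ℚ_[p])

/-- Multiplication matrices, as a map of `ℤ_p`-algebras. -/
def mulMatrix (V : Module.Basis (Fin r) ℚ_[p] E) : E →ₐ[ℤ_[p]] Matrix (Fin r) (Fin r) ℚ_[p] :=
  (Algebra.leftMulMatrix V).restrictScalars ℤ_[p]

theorem mulMatrix_injective (V : Module.Basis (Fin r) ℚ_[p] E) :
    Function.Injective (mulMatrix V) :=
  Algebra.leftMulMatrix_injective V

/-- The order of the elements that preserve the lattice spanned by a basis. -/
def multiplierOrder (V : Module.Basis (Fin r) ℚ_[p] E) : Subalgebra ℤ_[p] E :=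
  (matrixCoe p r).range.comap (mulMatrix V)

/-- By Cayley–Hamilton the characteristic polynomial of the integral matrix is a monic equation for
the element. -/
theorem multiplierOrder_le_integralClosure (V : Module.Basis (Fin r) ℚ_[p] E) :
    multiplierOrder V ≤ integralClosure ℤ_[p] E := by
  rintro c ⟨X, hX⟩
  refine ⟨X.charpoly, X.charpoly_monic, ?_⟩
  rw [← aeval_def]
  apply mulMatrix_injective V
  replace hX : matrixCoe p r X = mulMatrix V c := hX
  rw [← aeval_algHom_apply, ← hX, aeval_algHom_apply, Matrix.aeval_self_charpoly, map_zero,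
    map_zero]

instance isNoetherian_multiplierOrder (V : Module.Basis (Fin r) ℚ_[p] E) :
    IsNoetherian ℤ_[p] (multiplierOrder V).toSubmodule := by
  have e : Matrix (Fin r) (Fin r) ℤ_[p] ≃ₗ[ℤ_[p]] LinearMap.range (matrixCoe p r).toLinearMap :=
    LinearEquiv.ofInjective _ matrixCoe_injective
  have := isNoetherian_of_linearEquiv e
  let g : (multiplierOrder V).toSubmodule →ₗ[ℤ_[p]] LinearMap.range (matrixCoe p r).toLinearMap :=
    ((mulMatrix V).toLinearMap.comp (multiplierOrder V).toSubmodule.subtype).codRestrict _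
      fun c => c.2
  exact isNoetherian_of_injective g fun a b hab =>
    Subtype.ext (mulMatrix_injective V (congrArg Subtype.val hab))

/-- The multiples by `u` of the integral elements. -/
def integralMultiples (p : ℕ) [Fact p.Prime] {E : Type*} [CommRing E] [Algebra ℤ_[p] E] (u : E) :
    Submodule ℤ_[p] E :=
  (integralClosure ℤ_[p] E).toSubmodule.map (LinearMap.mulLeft ℤ_[p] u)

variable {ev : Fin r → E →ₐ[ℚ_[p]] PadicAlgCl p} {V : Module.Basis (Fin r) ℚ_[p] E} {x : E}
  {A : Matrix (Fin r) (Fin r) ℤ_[p]}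

theorem aeval_mem_multiplierOrder (hA : matrixCoe p r A = mulMatrix V x) (f : ℤ_[p][X]) :
    aeval x f ∈ multiplierOrder V :=
  ⟨aeval A f, aeval_eq_zero_iff_aeval_matrix hA f⟩

theorem norm_emb_le_of_mem_integralMultiples (hev : Function.Injective ev)
    (V : Module.Basis (Fin r) ℚ_[p] E) {u y : E}
    (hy : y ∈ integralMultiples p u) (i : Fin r) : ‖ev i y‖ ≤ ‖ev i u‖ := by
  obtain ⟨z, hz, rfl⟩ := hy
  rw [LinearMap.mulLeft_apply, map_mul, norm_mul]
  exact mul_le_of_le_one_right (norm_nonneg _)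
    ((isIntegral_iff_forall_norm_emb_le_one ev V hev z).1 hz i)

theorem norm_emb_le_one_of_matrixCoe (hev : Function.Injective ev)
    (hA : matrixCoe p r A = mulMatrix V x) (i : Fin r) : ‖ev i x‖ ≤ 1 :=
  (isIntegral_iff_forall_norm_emb_le_one ev V hev x).1
    (multiplierOrder_le_integralClosure V ⟨A, hA⟩) i

theorem exists_aeval_eq_of_mem_integralMultiples (hev : Function.Injective ev)
    (hA : matrixCoe p r A = mulMatrix V x) (hx : Function.Injective fun i => ev i x) {u : E}
    (hu : ∀ i, ‖ev i u‖ ≤ ‖rootDifferences fun i => ev i x‖) {y : E}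
    (hy : y ∈ integralMultiples p u) : ∃ g : ℤ_[p][X], aeval x g = y :=
  exists_aeval_eq_of_norm_le V hx (norm_emb_le_one_of_matrixCoe hev hA) fun i =>
    (norm_emb_le_of_mem_integralMultiples hev V hy i).trans (hu i)

theorem integralMultiples_le_multiplierOrder (hev : Function.Injective ev)
    (hA : matrixCoe p r A = mulMatrix V x) (hx : Function.Injective fun i => ev i x) {u : E}
    (hu : ∀ i, ‖ev i u‖ ≤ ‖rootDifferences fun i => ev i x‖) :
    integralMultiples p u ≤ (multiplierOrder V).toSubmodule := by
  intro y hy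
  obtain ⟨g, rfl⟩ := exists_aeval_eq_of_mem_integralMultiples hev hA hx hu hy
  exact aeval_mem_multiplierOrder hA g

/-- Multiplication by the unit `u` embeds the maximal order into the multiplier order, which is
Noetherian; it spans because it contains the powers of `x`. -/
theorem integralClosure_isLattice (hev : Function.Injective ev)
    (hA : matrixCoe p r A = mulMatrix V x) (hx : Function.Injective fun i => ev i x) {u : Eˣ}
    (hu : ∀ i, ‖ev i u‖ ≤ ‖rootDifferences fun i => ev i x‖) :
    Submodule.IsLattice ℚ_[p] (integralClosure ℤ_[p] E).toSubmodule where
  fg := by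
    let g : (integralClosure ℤ_[p] E).toSubmodule →ₗ[ℤ_[p]] (multiplierOrder V).toSubmodule :=
      ((LinearMap.mulLeft ℤ_[p] (u : E)).comp
        (integralClosure ℤ_[p] E).toSubmodule.subtype).codRestrict _ fun c =>
          integralMultiples_le_multiplierOrder hev hA hx hu ⟨c, c.2, rfl⟩
    have hg : Function.Injective g := fun a b hab =>
      Subtype.ext (u.isUnit.mul_left_cancel (congrArg Subtype.val hab))
    have := isNoetherian_of_injective g hg
    exact Module.Finite.iff_fg.1 inferInstance
  span_eq_top := by
    obtain ⟨B, hB⟩ := exists_powers_basis V x hx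
    rw [eq_top_iff, ← B.span_eq, Submodule.span_le]
    rintro _ ⟨j, rfl⟩
    rw [hB]
    exact Submodule.subset_span (pow_mem
      (show x ∈ integralClosure ℤ_[p] E from multiplierOrder_le_integralClosure V ⟨A, hA⟩) _)

/-- The index is the inverse norm of the determinant of multiplication by `u`, which is the norm of
`u` and hence the product of its conjugates. -/
theorem relIndex_integralMultiples (hev : Function.Injective ev)
    (hA : matrixCoe p r A = mulMatrix V x) (hx : Function.Injective fun i => ev i x) {u : Eˣ}
    (hu : ∀ i, ‖ev i u‖ ≤ ‖rootDifferences fun i => ev i x‖) :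
    ((integralMultiples p (u : E)).toAddSubgroup.relIndex
      (integralClosure ℤ_[p] E).toSubmodule.toAddSubgroup : ℝ) = (∏ i, ‖ev i u‖)⁻¹ := by
  have hlat := integralClosure_isLattice hev hA hx hu
  set O := (integralClosure ℤ_[p] E).toSubmodule with hO
  have hle : integralMultiples p (u : E) ≤ O :=
    (integralMultiples_le_multiplierOrder hev hA hx hu).trans (multiplierOrder_le_integralClosure V)
  let φ : O →ₗ[ℤ_[p]] O := (LinearMap.mulLeft ℤ_[p] (u : E)).restrict fun z hz => hle ⟨z, hz, rfl⟩
  let b := Module.Free.chooseBasis ℤ_[p] O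
  let b' := b.extendOfIsLattice ℚ_[p]
  have hb' : ∀ i, b' i = b i := fun i => Module.Basis.extendOfIsLattice_apply ℚ_[p] b i
  have hrepr : ∀ (z : O) i, b'.repr (z : E) i = algebraMap ℤ_[p] ℚ_[p] (b.repr z i) :=
    fun z i => Module.Basis.extendOfIsLattice_repr b z i
  have hdet : algebraMap ℤ_[p] ℚ_[p] (LinearMap.det φ) = Algebra.norm ℚ_[p] (u : E) := by
    rw [← LinearMap.det_toMatrix b, RingHom.map_det, Algebra.norm_eq_matrix_det b']
    congr 1
    ext i j
    rw [Algebra.leftMulMatrix_eq_repr_mul, hb', RingHom.mapMatrix_apply, Matrix.map_apply,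
      LinearMap.toMatrix_apply, ← hrepr]
    rfl
  have hnorm : ‖LinearMap.det φ‖ = ∏ i, ‖ev i u‖ := by
    rw [← norm_prod, ← algebraMap_norm_eq_prod ev V hev, norm_algebraMap', ← hdet]
    rfl
  have hne : LinearMap.det φ ≠ 0 := by
    rw [← norm_ne_zero_iff, hnorm]
    exact Finset.prod_ne_zero_iff.2 fun i _ => norm_ne_zero_iff.2
      ((u.isUnit.map (ev i)).ne_zero)
  rw [← hnorm, ← LinearMap.card_quotient_range φ hne]
  congr 1
  change _ = (LinearMap.range φ).toAddSubgroup.index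
  rw [AddSubgroup.relIndex]
  congr 1
  ext z
  constructor
  · rintro ⟨y, hy, h⟩
    exact ⟨⟨y, hy⟩, Subtype.ext h⟩
  · rintro ⟨y, rfl⟩
    exact ⟨y, y.2, rfl⟩

end Orders

/-! ### Index of the lattice of conjugates -/

section MultiplesIndex

variable {p : ℕ} [Fact p.Prime] {E : Type*} [CommRing E] [Algebra ℚ_[p] E] [Algebra ℤ_[p] E]
  [IsScalarTower ℤ_[p] ℚ_[p] E] {r : ℕ}

/-- The integral matrices of multiplication by the integral multiples of `u`. -/
def multiplesMatrix (V : Module.Basis (Fin r) ℚ_[p] E) (u : E) :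
    Submodule ℤ_[p] (Matrix (Fin r) (Fin r) ℤ_[p]) :=
  ((integralMultiples p u).map (mulMatrix V).toLinearMap).comap (matrixCoe p r).toLinearMap

theorem mem_multiplesMatrix {V : Module.Basis (Fin r) ℚ_[p] E} {u : E}
    {X : Matrix (Fin r) (Fin r) ℤ_[p]} :
    X ∈ multiplesMatrix V u ↔ ∃ y ∈ integralMultiples p u, mulMatrix V y = matrixCoe p r X :=
  Iff.rfl

variable {ev : Fin r → E →ₐ[ℚ_[p]] PadicAlgCl p} {V : Module.Basis (Fin r) ℚ_[p] E} {x : E}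
  {A : Matrix (Fin r) (Fin r) ℤ_[p]}

/-- A linear map that commutes with the generator `x` is `E`-linear, hence multiplication by its
value at `1`. -/
theorem mem_ker_commMap_iff (hgen : Algebra.adjoin ℚ_[p] {x} = ⊤)
    (hA : matrixCoe p r A = mulMatrix V x) (X : Matrix (Fin r) (Fin r) ℤ_[p]) :
    X ∈ LinearMap.ker A.commMap ↔ ∃ c : E, mulMatrix V c = matrixCoe p r X := by
  rw [Matrix.mem_ker_commMap]
  constructor
  · intro h
    have h1 : matrixCoe p r X * mulMatrix V x = mulMatrix V x * matrixCoe p r X := by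
      rw [← hA, ← map_mul, ← map_mul, h]
    let T : Module.End ℚ_[p] E := Matrix.toLin V V (matrixCoe p r X)
    have hT : ∀ y, T (x * y) = x * T y := by
      have h2 : T * Algebra.lmul ℚ_[p] E x = Algebra.lmul ℚ_[p] E x * T := by
        apply (LinearMap.toMatrix V V).injective
        rw [LinearMap.toMatrix_mul, LinearMap.toMatrix_mul]
        simp only [T, LinearMap.toMatrix_toLin]
        exact h1
      exact fun y => LinearMap.congr_fun h2 y
    refine ⟨T 1, ?_⟩
    have h3 : Algebra.lmul ℚ_[p] E (T 1) = T := by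
      ext y
      have := LatticeModule.endo_comm hgen T hT y 1
      rw [mul_one] at this
      rw [this, mul_comm]
      rfl
    have h4 : mulMatrix V (T 1) = LinearMap.toMatrix V V (Algebra.lmul ℚ_[p] E (T 1)) := rfl
    rw [h4, h3]
    exact LinearMap.toMatrix_toLin V V _
  · rintro ⟨c, hc⟩
    apply matrixCoe_injective
    rw [map_mul, map_mul, ← hc, hA, ← map_mul, ← map_mul, mul_comm]

theorem relIndex_multiplesMatrix (hgen : Algebra.adjoin ℚ_[p] {x} = ⊤)
    (hA : matrixCoe p r A = mulMatrix V x) {u : E}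
    (hu : integralMultiples p u ≤ (multiplierOrder V).toSubmodule) :
    (multiplesMatrix V u).toAddSubgroup.relIndex (LinearMap.ker A.commMap).toAddSubgroup =
      (integralMultiples p u).toAddSubgroup.relIndex
        (multiplierOrder V).toSubmodule.toAddSubgroup := by
  rw [← AddSubgroup.relIndex_map_map_of_injective (f := (matrixCoe p r).toLinearMap.toAddMonoidHom)
      _ _ (matrixCoe_injective (p := p) (r := r)),
    ← AddSubgroup.relIndex_map_map_of_injective (f := (mulMatrix V).toLinearMap.toAddMonoidHom)
      (integralMultiples p u).toAddSubgroup _ (mulMatrix_injective V)]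
  congr 1
  · ext Y
    constructor
    · rintro ⟨X, ⟨y, hy, hyX⟩, rfl⟩
      exact ⟨y, hy, hyX⟩
    · rintro ⟨y, hy, rfl⟩
      obtain ⟨X, hX⟩ := hu hy
      exact ⟨X, ⟨y, hy, hX.symm⟩, hX⟩
  · ext Y
    constructor
    · rintro ⟨X, hX, rfl⟩
      obtain ⟨c, hc⟩ := (mem_ker_commMap_iff hgen hA X).1 hX
      exact ⟨c, ⟨X, hc.symm⟩, hc⟩
    · rintro ⟨c, ⟨X, hX⟩, rfl⟩
      exact ⟨X, (mem_ker_commMap_iff hgen hA X).2 ⟨c, hX.symm⟩, hX⟩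

theorem multiplesMatrix_le_ker (hgen : Algebra.adjoin ℚ_[p] {x} = ⊤)
    (hA : matrixCoe p r A = mulMatrix V x) (u : E) :
    multiplesMatrix V u ≤ LinearMap.ker A.commMap := by
  rintro X ⟨y, -, hy⟩
  exact (mem_ker_commMap_iff hgen hA X).2 ⟨y, hy⟩

/-- By the modular law `(H ⊔ I) ⊓ K = H ⊔ (I ⊓ K) = H`. -/
theorem AddSubgroup.relIndex_sup_of_disjoint {G : Type*} [AddCommGroup G] {H K I : AddSubgroup G}
    (hHK : H ≤ K) (hKI : Disjoint K I) : (H ⊔ I).relIndex (K ⊔ I) = H.relIndex K := by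
  have h1 : K ⊔ I = K ⊔ (H ⊔ I) := by rw [← sup_assoc, sup_eq_left.2 hHK]
  rw [h1, AddSubgroup.relIndex_sup_right, ← AddSubgroup.inf_relIndex_right,
    sup_inf_assoc_of_le I hHK, inf_comm, hKI.eq_bot, sup_bot_eq]

theorem embMatrix_mul_map (hA : matrixCoe p r A = mulMatrix V x) :
    embMatrix ev V * A.map (algebraMap ℤ_[p] (PadicAlgCl p)) =
      Matrix.diagonal (fun i => ev i x) * embMatrix ev V := by
  rw [← embMatrix_mul_leftMulMatrix]
  congr 1
  have h : Algebra.leftMulMatrix V x = A.map (algebraMap ℤ_[p] ℚ_[p]) := hA.symm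
  rw [h, Matrix.map_map]
  rfl

/-- The index of the lattice that describes the conjugates of matrices near `A`. -/
theorem index_multiplesMatrix_sup_range (hgen : Algebra.adjoin ℚ_[p] {x} = ⊤)
    (hev : Function.Injective ev) (hA : matrixCoe p r A = mulMatrix V x)
    (hx : Function.Injective fun i => ev i x) {u : Eˣ}
    (hu : ∀ i, ‖ev i u‖ ≤ ‖rootDifferences fun i => ev i x‖) (N : ℕ) :
    ((multiplesMatrix V (u : E) ⊔
        LinearMap.range ((p : ℤ_[p]) ^ N • A.commMap)).toAddSubgroup.index : ℝ) *
      ((multiplierOrder V).toSubmodule.toAddSubgroup.relIndex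
        (integralClosure ℤ_[p] E).toSubmodule.toAddSubgroup : ℝ) =
      (p : ℝ) ^ (N * (r * r - r)) *
        ((∏ i, ‖ev i u‖) * ‖rootDifferences fun i => ev i x‖)⁻¹ := by
  have hW := embMatrix_isUnit_det ev V hev
  have hWA := embMatrix_mul_map (ev := ev) hA
  have hφ : Function.Injective (algebraMap ℤ_[p] (PadicAlgCl p)) := by
    rw [IsScalarTower.algebraMap_eq ℤ_[p] ℚ_[p] (PadicAlgCl p)]
    exact (algebraMap ℚ_[p] (PadicAlgCl p)).injective.comp (IsFractionRing.injective _ _)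
  have hle := integralMultiples_le_multiplierOrder hev hA hx hu
  set I := LinearMap.range ((p : ℤ_[p]) ^ N • A.commMap) with hI
  have hdisj : Disjoint (LinearMap.ker A.commMap) I := by
    refine (Matrix.disjoint_ker_range_commMap hφ hW hWA).mono_right ?_
    rintro _ ⟨T, rfl⟩
    exact ⟨(p : ℤ_[p]) ^ N • T, by simp⟩
  have hdisj' : Disjoint (LinearMap.ker A.commMap).toAddSubgroup I.toAddSubgroup := by
    rw [AddSubgroup.disjoint_def]
    intro y hy hy'
    exact Submodule.disjoint_def.1 hdisj y hy hy'
  have hm := multiplesMatrix_le_ker hgen hA (u : E)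
  -- The commutator kernel plus `I` lies between; below it the index is that of `u O_E` in the
  -- multiplier order, since `I` meets the kernel trivially.
  have h1 : (multiplesMatrix V (u : E) ⊔ I).toAddSubgroup.index =
      (integralMultiples p (u : E)).toAddSubgroup.relIndex
        (multiplierOrder V).toSubmodule.toAddSubgroup *
      (LinearMap.ker A.commMap ⊔ I).toAddSubgroup.index := by
    rw [← relIndex_multiplesMatrix hgen hA hle, ← AddSubgroup.relIndex_sup_of_disjoint
      (Submodule.toAddSubgroup_mono hm) hdisj', ← Submodule.sup_toAddSubgroup,
      ← Submodule.sup_toAddSubgroup, AddSubgroup.relIndex_mul_index]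
    exact Submodule.toAddSubgroup_mono (sup_le_sup_right hm I)
  have h2 := AddSubgroup.relIndex_mul_relIndex (integralMultiples p (u : E)).toAddSubgroup
    (multiplierOrder V).toSubmodule.toAddSubgroup
    (integralClosure ℤ_[p] E).toSubmodule.toAddSubgroup
    (Submodule.toAddSubgroup_mono hle)
    (Submodule.toAddSubgroup_mono (multiplierOrder_le_integralClosure V))
  have h3 := relIndex_integralMultiples hev hA hx hu
  have h4 := index_ker_sup_range_commMap hW hWA hx N
  rw [← h2] at h3
  push_cast at h3
  rw [h1, Nat.cast_mul, hI, h4, mul_inv, ← h3]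
  ring

/-- The product of the two indices is a nonzero real number, so neither takes the value `0` that
stands for an infinite index. -/
theorem index_multiplesMatrix_ne_zero (hgen : Algebra.adjoin ℚ_[p] {x} = ⊤)
    (hev : Function.Injective ev) (hA : matrixCoe p r A = mulMatrix V x)
    (hx : Function.Injective fun i => ev i x) {u : Eˣ}
    (hu : ∀ i, ‖ev i u‖ ≤ ‖rootDifferences fun i => ev i x‖) (N : ℕ) :
    (multiplesMatrix V (u : E) ⊔
        LinearMap.range ((p : ℤ_[p]) ^ N • A.commMap)).toAddSubgroup.index ≠ 0 ∧
      (multiplierOrder V).toSubmodule.toAddSubgroup.relIndex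
        (integralClosure ℤ_[p] E).toSubmodule.toAddSubgroup ≠ 0 := by
  have h := index_multiplesMatrix_sup_range hgen hev hA hx hu N
  have h0 : (p : ℝ) ^ (N * (r * r - r)) *
        ((∏ i, ‖ev i u‖) * ‖rootDifferences fun i => ev i x‖)⁻¹ ≠ 0 := by
    refine mul_ne_zero (pow_ne_zero _ (Nat.cast_ne_zero.2 (Fact.out : p.Prime).ne_zero))
      (inv_ne_zero (mul_ne_zero (Finset.prod_ne_zero_iff.2 fun i _ => norm_ne_zero_iff.2
        (u.isUnit.map (ev i)).ne_zero) (norm_ne_zero_iff.2 (rootDifferences_ne_zero hx))))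
  rw [← h] at h0
  exact ⟨fun h1 => h0 (by rw [h1]; simp), fun h1 => h0 (by rw [h1]; simp)⟩

end MultiplesIndex

/-! ### Commutators with polynomials in a matrix -/

section CommutatorRange

variable {R n : Type*} [CommRing R] [Fintype n] [DecidableEq n]

/-- Induction on powers: `[T, B^(k+1)] = [T, B^k] B + [B^k T, B]`, and the range of `[·, B]` is
stable under right multiplication by `B`. -/
theorem Matrix.commMap_aeval_mem_range (B : Matrix n n R) (g : R[X]) (T : Matrix n n R) :
    (aeval B g).commMap T ∈ LinearMap.range B.commMap := by
  induction g using Polynomial.induction_on' generalizing T with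
  | add f g hf hg =>
    have : (aeval B (f + g)).commMap T = (aeval B f).commMap T + (aeval B g).commMap T := by
      simp only [Matrix.commMap_apply, map_add]; noncomm_ring
    rw [this]
    exact Submodule.add_mem _ (hf T) (hg T)
  | monomial k a =>
    have hpow : ∀ T, (B ^ k).commMap T ∈ LinearMap.range B.commMap := by
      induction k with
      | zero => intro T; simp [Matrix.commMap_apply]
      | succ k ih =>
        intro T
        obtain ⟨S, hS⟩ := ih T
        refine ⟨S * B + B ^ k * T, ?_⟩
        have h1 : (B ^ (k + 1)).commMap T = (B ^ k).commMap T * B + B.commMap (B ^ k * T) := by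
          simp only [Matrix.commMap_apply]
          rw [pow_succ, Matrix.sub_mul, ← Matrix.mul_assoc B, ← pow_succ', ← pow_succ]
          simp only [pow_succ, Matrix.mul_assoc]
          abel
        rw [h1, ← hS]
        simp only [Matrix.commMap_apply]
        noncomm_ring
    rw [aeval_monomial, ← Algebra.smul_def]
    have : (a • B ^ k).commMap T = a • (B ^ k).commMap T := by
      simp [Matrix.commMap_apply, smul_sub]
    rw [this]
    exact Submodule.smul_mem _ a (hpow T)

end CommutatorRange

/-! ### Linearization of conjugation near the identity -/

section Conjugates

variable {p : ℕ} [Fact p.Prime] {r : ℕ}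

theorem isUnit_det_one_add_smul {N : ℕ} (hN : N ≠ 0) (T : Matrix (Fin r) (Fin r) ℤ_[p]) :
    IsUnit (1 + (p : ℤ_[p]) ^ N • T).det := by
  have h : PadicInt.toZMod (1 + (p : ℤ_[p]) ^ N • T).det = 1 := by
    rw [RingHom.map_det, map_add, map_one]
    have : (PadicInt.toZMod (p := p)).mapMatrix ((p : ℤ_[p]) ^ N • T) = 0 := by
      ext i j
      simp [hN]
    rw [this, add_zero, Matrix.det_one]
  by_contra hu
  have h2 : (1 + (p : ℤ_[p]) ^ N • T).det ∈ RingHom.ker (PadicInt.toZMod (p := p)) := by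
    rw [PadicInt.ker_toZMod]
    exact (IsLocalRing.mem_maximalIdeal _).2 hu
  rw [RingHom.mem_ker, h] at h2
  exact one_ne_zero h2

/-- A lattice of finite index contains a multiple of the standard one. -/
theorem exists_pow_smul_mem {M : Type*} [AddCommGroup M] [Module ℤ_[p] M]
    (G : Submodule ℤ_[p] M) (hG : G.toAddSubgroup.index ≠ 0) :
    ∃ c : ℕ, ∀ y : M, (p : ℤ_[p]) ^ c • y ∈ G := by
  set n := G.toAddSubgroup.index with hn
  have hn0 : (n : ℤ_[p]) ≠ 0 := Nat.cast_ne_zero.2 hG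
  -- The index `n` kills the quotient and is a unit times `p` to this exponent.
  refine ⟨(n : ℤ_[p]).valuation, fun y => ?_⟩
  have h := PadicInt.unitCoeff_spec hn0
  generalize PadicInt.unitCoeff hn0 = w at h
  have h1 : (p : ℤ_[p]) ^ (n : ℤ_[p]).valuation = ((w⁻¹ : ℤ_[p]ˣ) : ℤ_[p]) * (n : ℤ_[p]) := by
    conv_rhs => rw [h]
    rw [← mul_assoc, Units.inv_mul, one_mul]
  rw [h1, mul_smul]
  refine G.smul_mem _ ?_
  rw [Nat.cast_smul_eq_nsmul]
  exact AddSubgroup.nsmul_index_mem G.toAddSubgroup y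

instance compactSpace_matrix_padicInt : CompactSpace (Matrix (Fin r) (Fin r) ℤ_[p]) :=
  inferInstanceAs (CompactSpace (Fin r → Fin r → ℤ_[p]))

/-- The conjugates of `F ∈ 𝓕` by matrices that are close to the identity. -/
def nearConjugates (𝓕 : Set (Matrix (Fin r) (Fin r) ℤ_[p])) (N : ℕ) :
    Set (Matrix (Fin r) (Fin r) ℤ_[p]) :=
  {B | ∃ T, ∃ F ∈ 𝓕, B * (1 + (p : ℤ_[p]) ^ N • T) = (1 + (p : ℤ_[p]) ^ N • T) * F}

theorem conjugateSet_eq_nearConjugates (A : Matrix (Fin r) (Fin r) ℤ_[p]) (P : Set ℤ_[p][X])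
    {N : ℕ} (hN : N ≠ 0) :
    conjugateSet A P N = nearConjugates ((fun f => aeval A f) '' P) N := by
  ext B
  constructor
  · rintro ⟨T, f, hf, rfl⟩
    refine ⟨T, _, ⟨f, hf, rfl⟩, ?_⟩
    rw [Matrix.mul_assoc, Matrix.nonsing_inv_mul _ (isUnit_det_one_add_smul hN T), Matrix.mul_one]
  · rintro ⟨T, _, ⟨f, hf, rfl⟩, h⟩
    refine ⟨T, f, hf, ?_⟩
    rw [← h, Matrix.mul_assoc, Matrix.mul_nonsing_inv _ (isUnit_det_one_add_smul hN T),
      Matrix.mul_one]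

/-- The equation without an inverse is polynomial, so the set is the projection of a closed subset
of a compact space. -/
theorem isClosed_nearConjugates {𝓕 : Set (Matrix (Fin r) (Fin r) ℤ_[p])} (h𝓕 : IsClosed 𝓕)
    (N : ℕ) : IsClosed (nearConjugates 𝓕 N) := by
  have h1 : nearConjugates 𝓕 N = (fun q : Matrix (Fin r) (Fin r) ℤ_[p] ×
      Matrix (Fin r) (Fin r) ℤ_[p] × Matrix (Fin r) (Fin r) ℤ_[p] => q.2.2) ''
      {q | q.2.1 ∈ 𝓕 ∧
        q.2.2 * (1 + (p : ℤ_[p]) ^ N • q.1) = (1 + (p : ℤ_[p]) ^ N • q.1) * q.2.1} := by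
    ext B
    constructor
    · rintro ⟨T, F, hF, h⟩
      exact ⟨(T, F, B), ⟨hF, h⟩, rfl⟩
    · rintro ⟨⟨T, F, B⟩, ⟨hF, h⟩, rfl⟩
      exact ⟨T, F, hF, h⟩
  rw [h1]
  refine (IsCompact.image ?_ (by fun_prop)).isClosed
  refine IsClosed.isCompact ((h𝓕.preimage (by fun_prop)).inter (isClosed_eq ?_ ?_)) <;> fun_prop

theorem mem_of_isClosed_of_forall_pow {S : Set (Matrix (Fin r) (Fin r) ℤ_[p])} (hS : IsClosed S)
    {B : Matrix (Fin r) (Fin r) ℤ_[p]}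
    (h : ∀ k : ℕ, ∃ Y, B + (p : ℤ_[p]) ^ k • Y ∈ S) : B ∈ S := by
  choose Y hY using h
  rw [← hS.closure_eq]
  refine mem_closure_of_tendsto (f := fun k : ℕ => B + (p : ℤ_[p]) ^ k • Y k)
    (b := Filter.atTop) ?_ (Filter.Eventually.of_forall hY)
  have h0 : Filter.Tendsto (fun k : ℕ => (p : ℤ_[p]) ^ k • Y k) Filter.atTop (nhds 0) := by
    refine tendsto_pi_nhds.2 fun i => tendsto_pi_nhds.2 fun j => ?_
    refine squeeze_zero_norm (a := fun k : ℕ => ((p : ℝ)⁻¹) ^ k) (fun k => ?_)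
      (tendsto_pow_atTop_nhds_zero_of_lt_one (by positivity)
        (inv_lt_one_of_one_lt₀ (Nat.one_lt_cast.2 (Fact.out : p.Prime).one_lt)))
    rw [Matrix.smul_apply, smul_eq_mul, norm_mul, norm_pow, PadicInt.norm_p]
    exact mul_le_of_le_one_right (by positivity) (PadicInt.norm_le_one _)
  simpa using tendsto_const_nhds.add h0

variable {A : Matrix (Fin r) (Fin r) ℤ_[p]}
  {Λ : Submodule ℤ_[p] (Matrix (Fin r) (Fin r) ℤ_[p])} {c N : ℕ}

/-- With `q = p ^ N`, the conjugate is `F + q [T, F]` plus `q²` times a matrix. The linear term lies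
in the scaled range because `F` and `A` have the same commutator range; `c ≤ N` lets one factor `q`
bring the quadratic term into `Λ` plus that range, and the other factor scales it. -/
theorem nearConjugates_subset
    (hI : ∀ w ∈ Λ, LinearMap.range (A + w).commMap = LinearMap.range A.commMap)
    (hc : ∀ Y, (p : ℤ_[p]) ^ c • Y ∈ Λ ⊔ LinearMap.range A.commMap) (hN : N ≠ 0) (hcN : c ≤ N) :
    nearConjugates ((fun w => A + w) '' (Λ : Set _)) N ⊆
      (fun w => A + w) '' (Λ ⊔ LinearMap.range ((p : ℤ_[p]) ^ N • A.commMap) :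
        Submodule ℤ_[p] (Matrix (Fin r) (Fin r) ℤ_[p])) := by
  rintro B ⟨T, _, ⟨w, hw, rfl⟩, h⟩
  beta_reduce at h
  set F := A + w with hF
  set q := (p : ℤ_[p]) ^ N with hq
  set U := 1 + q • T with hU
  have hdet := isUnit_det_one_add_smul hN T
  have hscale : ∀ Y ∈ Λ ⊔ LinearMap.range A.commMap,
      q • Y ∈ Λ ⊔ LinearMap.range (q • A.commMap) := by
    intro Y hY
    obtain ⟨y, hy, z, ⟨S, rfl⟩, rfl⟩ := Submodule.mem_sup.1 hY
    rw [smul_add]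
    exact Submodule.add_mem_sup (Λ.smul_mem _ hy) ⟨S, rfl⟩
  have hqmem : ∀ Y, q • Y ∈ Λ ⊔ LinearMap.range A.commMap := by
    intro Y
    rw [hq, ← Nat.sub_add_cancel hcN, pow_add, mul_smul]
    exact Submodule.smul_mem _ _ (hc Y)
  have h1 : B = F + (q • F.commMap T - q • q • (F.commMap T * (T * U⁻¹))) := by
    have hUinv : U⁻¹ = 1 - q • (T * U⁻¹) := by
      have : U * U⁻¹ = 1 := Matrix.mul_nonsing_inv _ hdet
      rw [hU, add_mul, one_mul, Matrix.smul_mul] at this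
      rw [← this]
      simp only [← hU]
      abel
    have h2 : (B - F) * U = q • F.commMap T := by
      rw [sub_mul, h, hU, Matrix.commMap_apply]
      simp only [add_mul, mul_add, Matrix.smul_mul, Matrix.mul_smul, smul_sub, one_mul, mul_one]
      abel
    have h3 : B - F = q • F.commMap T * U⁻¹ := by
      rw [← h2, Matrix.mul_assoc, Matrix.mul_nonsing_inv _ hdet, Matrix.mul_one]
    have h4 : q • F.commMap T * U⁻¹ = q • F.commMap T - q • q • (F.commMap T * (T * U⁻¹)) := by
      conv_lhs => rw [hUinv]
      simp [mul_sub]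
    rw [← h4, ← h3]; abel
  refine ⟨w + (q • F.commMap T - q • q • (F.commMap T * (T * U⁻¹))), ?_, ?_⟩
  · refine Submodule.add_mem _ (Submodule.mem_sup_left hw) (Submodule.sub_mem _ ?_ ?_)
    · apply hscale
      apply Submodule.mem_sup_right
      rw [← hI w hw]
      exact ⟨T, rfl⟩
    · exact hscale _ (hqmem _)
  · beta_reduce
    rw [← add_assoc, ← hF, ← h1]

/-- Newton iteration: the current error is split into a part in `Λ`, which corrects `w`, and a
commutator with the current `A + w`, which corrects the conjugating matrix. What remains is
quadratic in the correction. -/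
theorem exists_nearConjugates_approx
    (hI : ∀ w ∈ Λ, LinearMap.range (A + w).commMap = LinearMap.range A.commMap)
    (hc : ∀ Y, (p : ℤ_[p]) ^ c • Y ∈ Λ ⊔ LinearMap.range A.commMap) (hcN : c < N)
    {B : Matrix (Fin r) (Fin r) ℤ_[p]}
    (hB : B ∈ (fun w => A + w) '' (Λ ⊔ LinearMap.range ((p : ℤ_[p]) ^ N • A.commMap) :
        Submodule ℤ_[p] (Matrix (Fin r) (Fin r) ℤ_[p]))) (k : ℕ) :
    ∃ T, ∃ w ∈ Λ, ∃ Y, B * (1 + (p : ℤ_[p]) ^ N • T) =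
      (1 + (p : ℤ_[p]) ^ N • T) * (A + w) + (p : ℤ_[p]) ^ (2 * N + k) • Y := by
  induction k with
  | zero =>
    obtain ⟨y, hy, rfl⟩ := hB
    obtain ⟨w, hw, _, ⟨S, rfl⟩, rfl⟩ := Submodule.mem_sup.1 hy
    have hS : A.commMap S ∈ LinearMap.range (A + w).commMap := by rw [hI w hw]; exact ⟨S, rfl⟩
    obtain ⟨T, hT⟩ := hS
    -- To first order the conjugation by `1 + p ^ N • T` produces `B`; this `Y` is the second-order
    -- remainder.
    refine ⟨T, w, hw, (A + w).commMap T * T, ?_⟩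
    beta_reduce
    rw [LinearMap.smul_apply, ← hT, ← add_assoc, Matrix.commMap_apply, add_zero, two_mul, pow_add]
    generalize A + w = F
    simp only [add_mul, mul_add, sub_mul, Matrix.smul_mul, Matrix.mul_smul, smul_sub, one_mul,
      mul_one, smul_smul, Matrix.mul_assoc]
    abel
  | succ k ih =>
    obtain ⟨T, w, hw, Y, h⟩ := ih
    set U := 1 + (p : ℤ_[p]) ^ N • T with hU
    have hdet := isUnit_det_one_add_smul (by omega : N ≠ 0) T
    obtain ⟨g, hg, _, hS, hgS⟩ := Submodule.mem_sup.1 (hc (U⁻¹ * Y))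
    rw [← hI w hw] at hS
    obtain ⟨S, rfl⟩ := hS
    set F := A + w with hF
    set q := (p : ℤ_[p]) ^ (2 * N + k - c) with hq
    have hqY : (p : ℤ_[p]) ^ (2 * N + k) • Y = U * (q • (g + F.commMap S)) := by
      rw [hgS, smul_smul, hq, ← pow_add, Nat.sub_add_cancel (by omega), Matrix.mul_smul,
        ← Matrix.mul_assoc, Matrix.mul_nonsing_inv _ hdet, Matrix.one_mul]
    have hqN : q = (p : ℤ_[p]) ^ N * (p : ℤ_[p]) ^ (N + k - c) := by
      rw [hq, ← pow_add]; congr 1; omega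
    -- The splitting costs `p ^ c`; since `c < N`, the exponent `2 (2N + k - c)` still exceeds `2N +
    -- k`.
    have hqq : q * q = (p : ℤ_[p]) ^ (2 * N + (k + 1)) * (p : ℤ_[p]) ^ (2 * N + k - 2 * c - 1) := by
      rw [hq, ← pow_add, ← pow_add]; congr 1; omega
    refine ⟨T + (p : ℤ_[p]) ^ (N + k - c) • (U * S), w + q • g, Λ.add_mem hw (Λ.smul_mem _ hg),
      (p : ℤ_[p]) ^ (2 * N + k - 2 * c - 1) • (U * ((g + F.commMap S) * S - S * g)), ?_⟩
    have hU' : 1 + (p : ℤ_[p]) ^ N • (T + (p : ℤ_[p]) ^ (N + k - c) • (U * S)) =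
        U * (1 + q • S) := by
      rw [smul_add, smul_smul, ← hqN, ← add_assoc, ← hU, mul_add, mul_one, Matrix.mul_smul]
    rw [hU', smul_smul, ← hqq, ← Matrix.mul_assoc, h, hqY, ← add_assoc, ← hF,
      Matrix.commMap_apply]
    simp only [add_mul, mul_add, sub_mul, Matrix.smul_mul, Matrix.mul_smul, smul_sub, mul_one,
      smul_smul, Matrix.mul_assoc, mul_sub, smul_add]
    abel

theorem subset_nearConjugates
    (hI : ∀ w ∈ Λ, LinearMap.range (A + w).commMap = LinearMap.range A.commMap)
    (hc : ∀ Y, (p : ℤ_[p]) ^ c • Y ∈ Λ ⊔ LinearMap.range A.commMap) (hcN : c < N) :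
    (fun w => A + w) '' (Λ ⊔ LinearMap.range ((p : ℤ_[p]) ^ N • A.commMap) :
        Submodule ℤ_[p] (Matrix (Fin r) (Fin r) ℤ_[p])) ⊆
      nearConjugates ((fun w => A + w) '' (Λ : Set _)) N := by
  intro B hB
  have hclosed : IsClosed ((fun w => A + w) '' (Λ : Set (Matrix (Fin r) (Fin r) ℤ_[p]))) :=
    (Λ.isCompact_of_isNoetherian.image (by fun_prop)).isClosed
  refine mem_of_isClosed_of_forall_pow (isClosed_nearConjugates hclosed N) fun k => ?_
  obtain ⟨T, w, hw, Y, h⟩ := exists_nearConjugates_approx hI hc hcN hB k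
  have hdet := isUnit_det_one_add_smul (by omega : N ≠ 0) T
  -- The error is moved into `B`: the corrected matrix is an exact conjugate, so `B` is a limit of
  -- such conjugates and the iterates `T` need not converge.
  refine ⟨-((p : ℤ_[p]) ^ (2 * N) • (Y * (1 + (p : ℤ_[p]) ^ N • T)⁻¹)), T, _, ⟨w, hw, rfl⟩, ?_⟩
  rw [add_mul, h, smul_neg, smul_smul, ← pow_add, add_comm k, neg_mul, Matrix.smul_mul,
    Matrix.mul_assoc, Matrix.nonsing_inv_mul _ hdet, Matrix.mul_one]
  abel

end Conjugates

/-! ### Measure of the set of conjugates -/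

section MeasureOfConjugates

variable {p : ℕ} [Fact p.Prime] {E : Type*} [CommRing E] [Algebra ℚ_[p] E] [Algebra ℤ_[p] E]
  [IsScalarTower ℤ_[p] ℚ_[p] E] {r : ℕ} {ev : Fin r → E →ₐ[ℚ_[p]] PadicAlgCl p}
  {V : Module.Basis (Fin r) ℚ_[p] E} {x : E} {A : Matrix (Fin r) (Fin r) ℤ_[p]}

/-- Each `y ∈ u O_E` equals `g(x)` with `g` integral, so `x + y` is the value of `X + g`, reduced to
degree below `r`. -/
theorem image_aeval_eq_add_multiplesMatrix (hev : Function.Injective ev)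
    (hA : matrixCoe p r A = mulMatrix V x) (hx : Function.Injective fun i => ev i x) {u : E}
    (hu : ∀ i, ‖ev i u‖ ≤ ‖rootDifferences fun i => ev i x‖) :
    (fun f => aeval A f) ''
        {f : ℤ_[p][X] | f.degree < (r : WithBot ℕ) ∧ aeval x f - x ∈ integralMultiples p u} =
      (fun w => A + w) '' (multiplesMatrix V u : Set (Matrix (Fin r) (Fin r) ℤ_[p])) := by
  have hmap : ∀ f : ℤ_[p][X], matrixCoe p r (aeval A f) = mulMatrix V (aeval x f) := fun f =>
    aeval_eq_zero_iff_aeval_matrix hA f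
  ext B
  constructor
  · rintro ⟨f, ⟨-, hf⟩, rfl⟩
    refine ⟨aeval A f - A, mem_multiplesMatrix.2 ⟨_, hf, ?_⟩, by simp⟩
    rw [map_sub, map_sub, hmap, hA]
  · rintro ⟨w, hw, rfl⟩
    obtain ⟨y, hy, hyw⟩ := mem_multiplesMatrix.1 hw
    obtain ⟨g, hg⟩ := exists_aeval_eq_of_mem_integralMultiples hev hA hx hu hy
    obtain ⟨f, hf, hfx⟩ := exists_degree_lt_aeval_eq hA (X + g)
    have hfy : aeval x f = x + y := by rw [hfx, map_add, aeval_X, hg]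
    refine ⟨f, ⟨hf, by rw [hfy, add_sub_cancel_left]; exact hy⟩, ?_⟩
    apply matrixCoe_injective
    beta_reduce
    rw [hmap, hfy, map_add, map_add, hA, hyw]

/-- Such a matrix is `f(A)` with `f(x)` close to `x`, so `A` is in turn a polynomial in it, and each
commutator range contains the other. -/
theorem range_commMap_add_of_mem_multiplesMatrix (hev : Function.Injective ev)
    (hA : matrixCoe p r A = mulMatrix V x) (hx : Function.Injective fun i => ev i x) {u : E}
    (hu : ∀ i, ‖ev i u‖ ≤ ‖rootDifferences fun i => ev i x‖)
    (hu' : ∀ i j, i ≠ j → ‖ev i u‖ < ‖ev i x - ev j x‖) :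
    ∀ w ∈ multiplesMatrix V u, LinearMap.range (A + w).commMap = LinearMap.range A.commMap := by
  intro w hw
  have h1 : A + w ∈ (fun f => aeval A f) ''
      {f : ℤ_[p][X] | f.degree < (r : WithBot ℕ) ∧ aeval x f - x ∈ integralMultiples p u} := by
    rw [image_aeval_eq_add_multiplesMatrix hev hA hx hu]; exact ⟨w, hw, rfl⟩
  obtain ⟨f, ⟨-, hf⟩, hfA⟩ := h1
  obtain ⟨h, hh⟩ := exists_aeval_aeval_eq_self (ev := ev) hA hx (f := f) fun i j hij => by
    rw [← map_sub]
    exact (norm_emb_le_of_mem_integralMultiples hev V hf i).trans_lt (hu' i j hij)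
  have hAh : aeval (aeval A f) h = A := by
    apply matrixCoe_injective
    have hmap : ∀ f : ℤ_[p][X], matrixCoe p r (aeval A f) = mulMatrix V (aeval x f) := fun f =>
      aeval_eq_zero_iff_aeval_matrix hA f
    rw [← aeval_algHom_apply, hmap, aeval_algHom_apply, hh, hA]
  beta_reduce at hfA
  rw [← hfA]
  apply le_antisymm
  · rintro _ ⟨T, rfl⟩
    exact Matrix.commMap_aeval_mem_range A f T
  · rintro _ ⟨T, rfl⟩
    have := Matrix.commMap_aeval_mem_range (aeval A f) h T
    rwa [hAh] at this

theorem conjugateSet_eventually_eq (hgen : Algebra.adjoin ℚ_[p] {x} = ⊤)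
    (hev : Function.Injective ev) (hA : matrixCoe p r A = mulMatrix V x)
    (hx : Function.Injective fun i => ev i x) {u : Eˣ}
    (hu : ∀ i, ‖ev i u‖ ≤ ‖rootDifferences fun i => ev i x‖)
    (hu' : ∀ i j, i ≠ j → ‖ev i u‖ < ‖ev i x - ev j x‖) :
    ∃ N₀ : ℕ, ∀ N : ℕ, N₀ ≤ N → conjugateSet A
        {f : ℤ_[p][X] | f.degree < (r : WithBot ℕ) ∧
          aeval x f - x ∈ integralMultiples p (u : E)} N =
      (fun w => A + w) '' (multiplesMatrix V (u : E) ⊔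
        LinearMap.range ((p : ℤ_[p]) ^ N • A.commMap) :
          Submodule ℤ_[p] (Matrix (Fin r) (Fin r) ℤ_[p])) := by
  -- The case `N = 0` bounds the denominator `p ^ c` needed to split a matrix into `Λ` plus
  -- commutators, which fixes the threshold `c + 1`.
  have h0 := (index_multiplesMatrix_ne_zero hgen hev hA hx hu 0).1
  rw [pow_zero, one_smul] at h0
  obtain ⟨c, hc⟩ := exists_pow_smul_mem _ h0
  have hI := range_commMap_add_of_mem_multiplesMatrix hev hA hx hu hu'
  refine ⟨c + 1, fun N hN => ?_⟩
  rw [conjugateSet_eq_nearConjugates _ _ (by omega),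
    image_aeval_eq_add_multiplesMatrix hev hA hx hu]
  exact (nearConjugates_subset hI hc (by omega) (by omega)).antisymm
    (subset_nearConjugates hI hc (by omega))

/-- The measure of the set of the matrices that are conjugate, by a matrix close to the identity,
to an integral polynomial in `A` that is close to `A`. -/
theorem measureReal_conjugateSet (hgen : Algebra.adjoin ℚ_[p] {x} = ⊤)
    (hev : Function.Injective ev) (hA : matrixCoe p r A = mulMatrix V x)
    (hx : Function.Injective fun i => ev i x) {u : Eˣ}
    (hu : ∀ i, ‖ev i u‖ ≤ ‖rootDifferences fun i => ev i x‖)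
    (hu' : ∀ i j, i ≠ j → ‖ev i u‖ < ‖ev i x - ev j x‖)
    [MeasurableSpace (Matrix (Fin r) (Fin r) ℤ_[p])] [BorelSpace (Matrix (Fin r) (Fin r) ℤ_[p])]
    (μ : MeasureTheory.Measure (Matrix (Fin r) (Fin r) ℤ_[p])) [μ.IsAddHaarMeasure]
    [MeasureTheory.IsProbabilityMeasure μ] :
    ∃ N₀ : ℕ, ∀ N : ℕ, N₀ ≤ N →
      MeasurableSet (conjugateSet A {f : ℤ_[p][X] | f.degree < (r : WithBot ℕ) ∧
          aeval x f - x ∈ integralMultiples p (u : E)} N) ∧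
      μ.real (conjugateSet A {f : ℤ_[p][X] | f.degree < (r : WithBot ℕ) ∧
          aeval x f - x ∈ integralMultiples p (u : E)} N) =
        ((multiplierOrder V).toSubmodule.toAddSubgroup.relIndex
          (integralClosure ℤ_[p] E).toSubmodule.toAddSubgroup : ℝ) *
        ((∏ i, ‖ev i u‖) * ‖rootDifferences fun i => ev i x‖) /
        (p : ℝ) ^ (N * (r * r - r)) := by
  obtain ⟨N₀, hN₀⟩ := conjugateSet_eventually_eq hgen hev hA hx hu hu'
  refine ⟨N₀, fun N hN => ?_⟩
  rw [hN₀ N hN]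
  set G := multiplesMatrix V (u : E) ⊔ LinearMap.range ((p : ℤ_[p]) ^ N • A.commMap) with hG
  have hcl : IsClosed (G : Set (Matrix (Fin r) (Fin r) ℤ_[p])) :=
    G.isCompact_of_isNoetherian.isClosed
  obtain ⟨hidx, hrel⟩ := index_multiplesMatrix_ne_zero hgen hev hA hx hu N
  refine ⟨((Homeomorph.addLeft A).isClosedMap _ hcl).measurableSet, ?_⟩
  have h1 := measureReal_vadd_addSubgroup μ G.toAddSubgroup hcl hidx A
  rw [Submodule.coe_toAddSubgroup] at h1
  rw [h1]
  have h2 := index_multiplesMatrix_sup_range hgen hev hA hx hu N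
  rw [← hG] at h2
  have hp : (p : ℝ) ^ (N * (r * r - r)) ≠ 0 :=
    pow_ne_zero _ (Nat.cast_ne_zero.2 (Fact.out : p.Prime).ne_zero)
  have hidx' : (G.toAddSubgroup.index : ℝ) ≠ 0 := Nat.cast_ne_zero.2 hidx
  have hc : (∏ i, ‖ev i u‖) * ‖rootDifferences fun i => ev i x‖ ≠ 0 :=
    mul_ne_zero (Finset.prod_ne_zero_iff.2 fun i _ => norm_ne_zero_iff.2
      (u.isUnit.map (ev i)).ne_zero) (norm_ne_zero_iff.2 (rootDifferences_ne_zero hx))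
  have h3 := (eq_mul_inv_iff_mul_eq₀ hc).1 h2
  rw [eq_div_iff hp, ← h3, mul_assoc (G.toAddSubgroup.index : ℝ), inv_mul_cancel_left₀ hidx']

end MeasureOfConjugates

/-! ### Uniformizers, ramification and valuations -/

section Uniformizer

variable {p : ℕ} [Fact p.Prime] {K : Type*} [Field K] [Algebra ℚ_[p] K]

theorem spectralNorm_eq_norm_emb (σ : K →ₐ[ℚ_[p]] PadicAlgCl p) (y : K) :
    spectralNorm ℚ_[p] K y = ‖σ y‖ := by
  rw [← PadicAlgCl.spectralNorm_eq, spectralNorm, spectralNorm,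
    minpoly.algHom_eq σ σ.injective]

variable [FiniteDimensional ℚ_[p] K] [Algebra ℤ_[p] K] [IsScalarTower ℤ_[p] ℚ_[p] K]

theorem isIntegral_iff_norm_emb_le_one (σ : K →ₐ[ℚ_[p]] PadicAlgCl p) (y : K) :
    IsIntegral ℤ_[p] y ↔ ‖σ y‖ ≤ 1 := by
  rw [← spectralNorm_eq_norm_emb, spectralNorm_le_one_iff_isIntegral]

theorem ramificationIdx_eq_of_pow_dvd {ϖ : integralClosure ℤ_[p] K}
    (hϖ : (Ideal.span {ϖ}).IsMaximal) {n : ℕ} (h : ϖ ^ n ∣ (p : integralClosure ℤ_[p] K))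
    (h' : ¬ ϖ ^ (n + 1) ∣ (p : integralClosure ℤ_[p] K)) :
    (Ideal.span {ϖ}).ramificationIdx ℤ_[p] = n := by
  have hded : IsDedekindDomain (integralClosure ℤ_[p] K) :=
    integralClosure.isDedekindDomain ℤ_[p] ℚ_[p] K
  have hover : (Ideal.span {ϖ}).LiesOver (IsLocalRing.maximalIdeal ℤ_[p]) :=
    ⟨(IsLocalRing.eq_maximalIdeal
      (Ideal.isMaximal_comap_of_isIntegral_of_isMaximal (Ideal.span {ϖ}))).symm⟩
  have hmap : (IsLocalRing.maximalIdeal ℤ_[p]).map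
      (algebraMap ℤ_[p] (integralClosure ℤ_[p] K)) = Ideal.span {(p : integralClosure ℤ_[p] K)} := by
    rw [PadicInt.maximalIdeal_eq_span_p, Ideal.map_span, Set.image_singleton, map_natCast]
  have hp0 : (p : integralClosure ℤ_[p] K) ≠ 0 := by
    have : CharZero K := charZero_of_injective_algebraMap (algebraMap ℚ_[p] K).injective
    intro h0
    have h1 := congrArg Subtype.val h0
    exact (Fact.out : p.Prime).ne_zero ((Nat.cast_eq_zero (R := K)).1 h1)
  rw [← Ideal.ramificationIdx'_eq_ramificationIdx' (IsLocalRing.maximalIdeal ℤ_[p])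
    (Ideal.span {ϖ}) (by rw [hmap, Ne, Ideal.span_singleton_eq_bot]; exact hp0)]
  apply Ideal.ramificationIdx'_spec
  · rw [hmap, Ideal.span_singleton_pow, Ideal.span_singleton_le_span_singleton]
    exact h
  · rw [hmap, Ideal.span_singleton_pow, Ideal.span_singleton_le_span_singleton]
    exact h'

/-- The norm of a uniformizer is determined by the ramification index. -/
theorem norm_emb_uniformizer_pow (σ : K →ₐ[ℚ_[p]] PadicAlgCl p) {ϖ : integralClosure ℤ_[p] K}
    (hϖ : (Ideal.span {ϖ}).IsMaximal) :
    (Ideal.span {ϖ}).ramificationIdx ℤ_[p] ≠ 0 ∧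
      ‖σ (ϖ : K)‖ ^ (Ideal.span {ϖ}).ramificationIdx ℤ_[p] = (p : ℝ)⁻¹ := by
  have hle : ∀ y : integralClosure ℤ_[p] K, ‖σ (y : K)‖ ≤ 1 := fun y =>
    (isIntegral_iff_norm_emb_le_one σ _).1 y.2
  have hlt : ‖σ (ϖ : K)‖ < 1 := by
    refine lt_of_le_of_ne (hle ϖ) fun h1 => hϖ.ne_top ?_
    rw [Ideal.span_singleton_eq_top]
    have h0 : (ϖ : K) ≠ 0 := by
      intro h0; rw [h0, map_zero, norm_zero] at h1; exact zero_ne_one h1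
    have hinv : IsIntegral ℤ_[p] (ϖ : K)⁻¹ := by
      rw [isIntegral_iff_norm_emb_le_one σ, map_inv₀, norm_inv, h1, inv_one]
    exact IsUnit.of_mul_eq_one (⟨_, hinv⟩ : integralClosure ℤ_[p] K)
      (Subtype.ext (mul_inv_cancel₀ h0))
  have hnp : ‖σ (((p : integralClosure ℤ_[p] K)) : K)‖ = (p : ℝ)⁻¹ := by
    change ‖σ ((p : ℕ) : K)‖ = _
    rw [map_natCast, ← map_natCast (algebraMap ℚ_[p] (PadicAlgCl p)),
      norm_algebraMap', Padic.norm_p]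
  have hp1 : (1 : ℝ) < p := Nat.one_lt_cast.2 (Fact.out : p.Prime).one_lt
  have hex : ∃ n : ℕ, ¬ ϖ ^ (n + 1) ∣ (p : integralClosure ℤ_[p] K) := by
    obtain ⟨n, hn⟩ := exists_pow_lt_of_lt_one (show (0 : ℝ) < (p : ℝ)⁻¹ by positivity) hlt
    refine ⟨n, fun ⟨w, hw⟩ => ?_⟩
    rw [hw] at hnp
    have : (p : ℝ)⁻¹ ≤ ‖σ (ϖ : K)‖ ^ n := by
      rw [← hnp, MulMemClass.coe_mul, SubmonoidClass.coe_pow, map_mul, map_pow, norm_mul, norm_pow]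
      exact (mul_le_of_le_one_right (by positivity) (hle w)).trans
        (pow_le_pow_of_le_one (norm_nonneg _) hlt.le (Nat.le_succ n))
    exact absurd hn (not_lt.2 this)
  classical
  -- The largest `n` with `ϖ ^ n ∣ p`; it exists because the powers of `ϖ` eventually have smaller
  -- norm than `p`.
  obtain ⟨n, hn, hdvd⟩ : ∃ n : ℕ, ¬ ϖ ^ (n + 1) ∣ (p : integralClosure ℤ_[p] K) ∧
      ϖ ^ n ∣ (p : integralClosure ℤ_[p] K) := by
    refine ⟨Nat.find hex, Nat.find_spec hex, ?_⟩
    rcases h : Nat.find hex with - | k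
    · simp
    · exact not_not.1 (Nat.find_min hex (m := k) (by omega))
  rw [ramificationIdx_eq_of_pow_dvd hϖ hdvd hn]
  obtain ⟨w, hw⟩ := hdvd
  have hw1 : ‖σ (w : K)‖ = 1 := by
    have hwn : w ∉ Ideal.span {ϖ} := by
      rw [Ideal.mem_span_singleton]
      rintro ⟨z, rfl⟩
      exact hn ⟨z, by rw [hw]; ring⟩
    -- The cofactor `w` is invertible modulo `ϖ`; if `‖w‖ < 1`, the relation `1 = y w + ϖ z` would
    -- contradict the ultrametric inequality.
    obtain ⟨y, i, hi, hyi⟩ := hϖ.exists_inv hwn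
    obtain ⟨z, rfl⟩ := Ideal.mem_span_singleton.1 hi
    refine le_antisymm (hle w) ?_
    by_contra hlt'
    push Not at hlt'
    have h1 := congrArg (fun t : integralClosure ℤ_[p] K => σ (t : K)) hyi
    simp only [AddMemClass.coe_add, MulMemClass.coe_mul, map_add, map_mul, OneMemClass.coe_one,
      map_one] at h1
    have h2 : ‖σ (y : K) * σ (w : K) + σ (ϖ : K) * σ (z : K)‖ < 1 := by
      refine (IsUltrametricDist.norm_add_le_max _ _).trans_lt (max_lt ?_ ?_)
      · rw [norm_mul]
        exact (mul_le_of_le_one_left (norm_nonneg _) (hle y)).trans_lt hlt'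
      · rw [norm_mul]
        exact (mul_le_of_le_one_right (norm_nonneg _) (hle z)).trans_lt hlt
    rw [h1, norm_one] at h2
    exact lt_irrefl _ h2
  have hpow : ‖σ (ϖ : K)‖ ^ n = (p : ℝ)⁻¹ := by
    rw [← hnp, hw, MulMemClass.coe_mul, SubmonoidClass.coe_pow, map_mul, map_pow, norm_mul,
      norm_pow, hw1, mul_one]
  refine ⟨?_, hpow⟩
  rintro rfl
  rw [pow_zero] at hpow
  exact hp1.ne' (inv_eq_one.1 hpow.symm)

omit [FiniteDimensional ℚ_[p] K] [Algebra ℤ_[p] K] [IsScalarTower ℤ_[p] ℚ_[p] K] in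
/-- The inequality of valuations, in terms of norms. -/
theorem coe_le_extVal_add_extVal_iff (σ : K →ₐ[ℚ_[p]] PadicAlgCl p) {a b : K} (hb : b ≠ 0)
    (s : ℝ) : ((s : ℝ) : WithTop ℝ) ≤ extVal p a + extVal p b ↔
      ‖σ a‖ * ‖σ b‖ ≤ (p : ℝ) ^ (-s) := by
  have hp1 : (1 : ℝ) < p := Nat.one_lt_cast.2 (Fact.out : p.Prime).one_lt
  by_cases ha : a = 0
  · simp only [extVal, ha, if_true, top_add, le_top, map_zero, norm_zero, zero_mul, true_iff]
    positivity
  · have hσa : 0 < ‖σ a‖ := norm_pos_iff.2 ((map_ne_zero σ).2 ha)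
    have hσb : 0 < ‖σ b‖ := norm_pos_iff.2 ((map_ne_zero σ).2 hb)
    simp only [extVal, ha, hb, if_false, spectralNorm_eq_norm_emb σ]
    rw [← WithTop.coe_add, WithTop.coe_le_coe, ← Real.logb_le_iff_le_rpow hp1 (mul_pos hσa hσb),
      Real.logb_mul hσa.ne' hσb.ne']
    constructor <;> intro h <;> linarith

end Uniformizer

/-! ### Embeddings of a product of fields -/

section Embeddings

variable {p : ℕ} [Fact p.Prime] {m : ℕ} {K : Fin m → Type*} [∀ i, Field (K i)]
  [∀ i, Algebra ℚ_[p] (K i)] [∀ i, FiniteDimensional ℚ_[p] (K i)]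

/-- The number of embeddings of a product of fields. -/
theorem card_sigma_algHom :
    Nat.card (Σ i, (K i →ₐ[ℚ_[p]] PadicAlgCl p)) = Module.finrank ℚ_[p] (∀ i, K i) := by
  rw [Nat.card_sigma, Module.finrank_pi_fintype]
  refine Finset.sum_congr rfl fun i _ => ?_
  rw [Nat.card_eq_fintype_card, AlgHom.card]

/-- The embedding of the product of the `K i` that an embedding of one factor defines. -/
def sigmaEmb (q : Σ i, (K i →ₐ[ℚ_[p]] PadicAlgCl p)) : (∀ i, K i) →ₐ[ℚ_[p]] PadicAlgCl p :=
  q.2.comp (Pi.evalAlgHom ℚ_[p] K q.1)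

omit [∀ i, FiniteDimensional ℚ_[p] (K i)] in
theorem sigmaEmb_apply (q : Σ i, (K i →ₐ[ℚ_[p]] PadicAlgCl p)) (y : ∀ i, K i) :
    sigmaEmb q y = q.2 (y q.1) := rfl

omit [∀ i, FiniteDimensional ℚ_[p] (K i)] in
theorem sigmaEmb_injective : Function.Injective (sigmaEmb (p := p) (K := K)) := by
  rintro ⟨i, σ⟩ ⟨j, τ⟩ h
  have h1 : ∀ y : ∀ i, K i, σ (y i) = τ (y j) := fun y => DFunLike.congr_fun h y
  have hij : i = j := by
    by_contra hne
    have := h1 (Pi.single i 1)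
    rw [Pi.single_eq_same, Pi.single_eq_of_ne (Ne.symm hne), map_one, map_zero] at this
    exact one_ne_zero this
  subst hij
  congr 1
  ext y
  have := h1 (Pi.single i y)
  rwa [Pi.single_eq_same] at this

theorem emb_injective_of_adjoin_eq_top {E : Type*} [CommRing E] [Algebra ℚ_[p] E] {x : E}
    (hgen : Algebra.adjoin ℚ_[p] {x} = ⊤) {ι : Type*} {ev : ι → E →ₐ[ℚ_[p]] PadicAlgCl p}
    (hev : Function.Injective ev) : Function.Injective fun i => ev i x := fun i j hij =>
  hev (AlgHom.ext_of_adjoin_eq_top hgen (by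
    intro y hy
    rw [Set.mem_singleton_iff.1 hy]
    exact hij))

end Embeddings

/-! ### The polynomial `Z`, its derivative and discriminant -/

section ProductOfMinpolys

theorem eval_derivative_prod_X_sub_C {F : Type*} [CommRing F] {r : ℕ} (l : Fin r → F) (i : Fin r) :
    eval (l i) (derivative (∏ j, (X - C (l j)))) = ∏ j ∈ Finset.univ.erase i, (l i - l j) := by
  rw [Polynomial.derivative_prod_finset, eval_finsetSum, Finset.sum_eq_single i]
  · simp [eval_prod]
  · intro j _ hji
    rw [eval_mul, eval_prod, Finset.prod_eq_zero (Finset.mem_erase.2 ⟨hji.symm, Finset.mem_univ i⟩)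
      (by simp), zero_mul]
  · simp

theorem Polynomial.map_discr_of_monic {F F' : Type*} [CommRing F] [Nontrivial F] [CommRing F']
    [Nontrivial F'] (φ : F →+* F') {f : F[X]} (hf : f.Monic) : (f.map φ).discr = φ f.discr := by
  rcases Nat.eq_zero_or_pos f.natDegree with h0 | h0
  · rw [hf.natDegree_eq_zero.1 h0, Polynomial.map_one, ← C_1, ← C_1, discr_C, discr_C, map_one]
  · have h1 := resultant_deriv (natDegree_pos_iff_degree_pos.1 h0)
    have h2 := resultant_deriv (f := f.map φ)
      (natDegree_pos_iff_degree_pos.1 (by rwa [hf.natDegree_map]))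
    rw [derivative_map, resultant_map_map, (hf.map φ).leadingCoeff, hf.natDegree_map, h1,
      hf.leadingCoeff, mul_one, mul_one, map_mul, map_pow, map_neg, map_one] at h2
    have h3 : IsUnit ((-1 : F') ^ (f.natDegree * (f.natDegree - 1) / 2)) :=
      isUnit_one.neg.pow _
    exact (h3.mul_left_cancel h2).symm

/-- Up to sign the discriminant is the resultant with the derivative, that is, the product of the
values of the derivative at the roots. -/
theorem norm_discr_prod_X_sub_C {F : Type*} [NormedField F] {r : ℕ} (l : Fin r → F) :
    ‖(∏ j, (X - C (l j)) : F[X]).discr‖ = ‖rootDifferences l‖ := by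
  rcases Nat.eq_zero_or_pos r with rfl | hr
  · have : (1 : F[X]).discr = 1 := by rw [← C_1, discr_C]
    simp [rootDifferences, this]
  set f : F[X] := ∏ j, (X - C (l j)) with hf
  have hdeg : f.natDegree = r := by simp [hf]
  have hmonic : f.Monic := monic_prod_of_monic _ _ fun j _ => monic_X_sub_C _
  have h1 := resultant_deriv (f := f) (natDegree_pos_iff_degree_pos.1 (by omega))
  have h2 : f.resultant (derivative f) f.natDegree (f.natDegree - 1) =
      ∏ i, eval (l i) (derivative f) := by
    conv_lhs => rw [hf]
    rw [← hf, hf, resultant_prod_left, ← hf]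
    · refine Finset.prod_congr rfl fun i _ => ?_
      rw [natDegree_X_sub_C, resultant_X_sub_C_left _ _ _ (natDegree_derivative_le f)]
    · simp
    · exact natDegree_derivative_le _
  rw [h2, hmonic.leadingCoeff, mul_one] at h1
  have h3 := congrArg norm h1
  rw [norm_mul, norm_pow, norm_neg, norm_one, one_pow, one_mul] at h3
  rw [← h3, rootDifferences]
  simp_rw [hf, eval_derivative_prod_X_sub_C]

variable {p : ℕ} [Fact p.Prime] {m : ℕ} {K : Fin m → Type*} [∀ i, Field (K i)]
  [∀ i, Algebra ℚ_[p] (K i)] [∀ i, FiniteDimensional ℚ_[p] (K i)] {r : ℕ}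

/-- Over an algebraic closure, the product of the minimal polynomials splits into the linear
factors given by the conjugates. -/
theorem map_minpolyProd_eq (hr : Module.finrank ℚ_[p] (∀ i, K i) = r) {x : ∀ i, K i}
    (e : Fin r → Σ i, (K i →ₐ[ℚ_[p]] PadicAlgCl p))
    (hx : Function.Injective fun j => sigmaEmb (e j) x) :
    (minpolyProd p x).map (algebraMap ℚ_[p] (PadicAlgCl p)) =
      ∏ j, (X - C (sigmaEmb (e j) x)) := by
  have hmonic : (minpolyProd p x).Monic := monic_prod_of_monic _ _ fun i _ =>
    minpoly.monic (Algebra.IsIntegral.isIntegral _)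
  -- The linear factors are coprime and divide `Z`, whose degree is at most `∑ [K i : ℚ_p] = r`.
  refine eq_of_monic_of_dvd_of_natDegree_le (monic_prod_of_monic _ _ fun j _ => monic_X_sub_C _)
    (hmonic.map _) (Finset.prod_dvd_of_coprime ((pairwise_coprime_X_sub_C hx).set_pairwise _)
      fun j _ => ?_) ?_
  · rw [dvd_iff_isRoot, IsRoot.def, eval_map_algebraMap, sigmaEmb_apply, aeval_algHom_apply,
      minpolyProd, map_prod, Finset.prod_eq_zero (Finset.mem_univ (e j).1) (minpoly.aeval _ _),
      map_zero]
  · rw [hmonic.natDegree_map, minpolyProd, natDegree_prod_of_monic _ _ fun i _ =>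
      minpoly.monic (Algebra.IsIntegral.isIntegral _)]
    simp only [natDegree_finsetProd_X_sub_C_eq_card, Finset.card_univ, Fintype.card_fin]
    rw [← hr, Module.finrank_pi_fintype]
    exact Finset.sum_le_sum fun i _ => minpoly.natDegree_le _

theorem emb_aeval_derivative_minpolyProd (hr : Module.finrank ℚ_[p] (∀ i, K i) = r) {x : ∀ i, K i}
    (e : Fin r → Σ i, (K i →ₐ[ℚ_[p]] PadicAlgCl p))
    (hx : Function.Injective fun j => sigmaEmb (e j) x) (j : Fin r) :
    (e j).2 (aeval (x (e j).1) (derivative (minpolyProd p x))) =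
      ∏ k ∈ Finset.univ.erase j, (sigmaEmb (e j) x - sigmaEmb (e k) x) := by
  rw [← eval_derivative_prod_X_sub_C fun j => sigmaEmb (e j) x, ← map_minpolyProd_eq hr e hx,
    derivative_map, eval_map_algebraMap, ← aeval_algHom_apply]
  rfl

/-- The valuation of the discriminant, in terms of the conjugates. -/
theorem norm_rootDifferences_eq (hr : Module.finrank ℚ_[p] (∀ i, K i) = r) {x : ∀ i, K i}
    (e : Fin r → Σ i, (K i →ₐ[ℚ_[p]] PadicAlgCl p))
    (hx : Function.Injective fun j => sigmaEmb (e j) x) :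
    ‖rootDifferences fun j => sigmaEmb (e j) x‖ = (p : ℝ) ^ (-(valDisc p x : ℝ)) := by
  have hmonic : (minpolyProd p x).Monic := monic_prod_of_monic _ _ fun i _ =>
    minpoly.monic (Algebra.IsIntegral.isIntegral _)
  have h1 : ‖(minpolyProd p x).discr‖ = ‖rootDifferences fun j => sigmaEmb (e j) x‖ := by
    rw [← norm_discr_prod_X_sub_C, ← map_minpolyProd_eq hr e hx,
      Polynomial.map_discr_of_monic _ hmonic, norm_algebraMap']
  have h0 : (minpolyProd p x).discr ≠ 0 := by
    rw [← norm_ne_zero_iff, h1]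
    exact norm_ne_zero_iff.2 (rootDifferences_ne_zero hx)
  rw [← h1, Padic.norm_eq_zpow_neg_valuation h0, ← Real.rpow_intCast]
  simp [valDisc]

end ProductOfMinpolys

/-! ### `End(C)` as the multiplier order -/

section EndomorphismRings

variable {p : ℕ} [Fact p.Prime] {E : Type*} [CommRing E] [Algebra ℚ_[p] E] [Algebra ℤ_[p] E]
  [IsScalarTower ℤ_[p] ℚ_[p] E] {r : ℕ}

/-- The basis of `E` over `ℚ_p` given by a basis of a lattice. -/
def LatticeModule.rationalBasis {x : E} (M : LatticeModule p x)
    (v : Module.Basis (Fin r) ℤ_[p] M.toSubmodule) : Module.Basis (Fin r) ℚ_[p] E :=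
  haveI := M.isLattice
  v.extendOfIsLattice ℚ_[p]

theorem LatticeModule.rationalBasis_apply {x : E} (M : LatticeModule p x)
    (v : Module.Basis (Fin r) ℤ_[p] M.toSubmodule) (i : Fin r) :
    M.rationalBasis v i = v i :=
  haveI := M.isLattice
  Module.Basis.extendOfIsLattice_apply ℚ_[p] v i

theorem LatticeModule.rationalBasis_repr {x : E} (M : LatticeModule p x)
    (v : Module.Basis (Fin r) ℤ_[p] M.toSubmodule) (z : M.toSubmodule) (i : Fin r) :
    (M.rationalBasis v).repr (z : E) i = algebraMap ℤ_[p] ℚ_[p] (v.repr z i) :=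
  haveI := M.isLattice
  Module.Basis.extendOfIsLattice_repr v z i

theorem LatticeModule.matrixCoe_toMatrix {x : E} (M : LatticeModule p x)
    (v : Module.Basis (Fin r) ℤ_[p] M.toSubmodule) {c : E}
    (hc : ∀ y ∈ M.toSubmodule, c * y ∈ M.toSubmodule) :
    matrixCoe p r (LinearMap.toMatrix v v ((LinearMap.mulLeft ℤ_[p] c).restrict
      (p := M.toSubmodule) (q := M.toSubmodule) hc)) = mulMatrix (M.rationalBasis v) c := by
  ext i j
  change _ = Algebra.leftMulMatrix (M.rationalBasis v) c i j
  rw [matrixCoe_apply, Matrix.map_apply, LinearMap.toMatrix_apply, ← M.rationalBasis_repr,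
    Algebra.leftMulMatrix_eq_repr_mul, M.rationalBasis_apply]
  rfl

theorem LatticeModule.matrixCoe_actionMatrix {x : E} (M : LatticeModule p x)
    (v : Module.Basis (Fin r) ℤ_[p] M.toSubmodule) :
    matrixCoe p r (M.actionMatrix v) = mulMatrix (M.rationalBasis v) x :=
  M.matrixCoe_toMatrix v _

theorem LatticeModule.mem_multiplierOrder_iff {x : E} (M : LatticeModule p x)
    (v : Module.Basis (Fin r) ℤ_[p] M.toSubmodule) {c : E} :
    c ∈ multiplierOrder (M.rationalBasis v) ↔ ∀ y ∈ M.toSubmodule, c * y ∈ M.toSubmodule := by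
  constructor
  · rintro ⟨X, hX⟩ y hy
    replace hX : matrixCoe p r X = Algebra.leftMulMatrix (M.rationalBasis v) c := hX
    have hv : ∀ j, c * (v j : E) ∈ M.toSubmodule := by
      intro j
      have h1 : c * (v j : E) = ((∑ i, X i j • v i : M.toSubmodule) : E) := by
        rw [← (M.rationalBasis v).sum_repr (c * (v j : E)), Submodule.coe_sum]
        refine Finset.sum_congr rfl fun i _ => ?_
        rw [← M.rationalBasis_apply, ← Algebra.leftMulMatrix_eq_repr_mul, ← hX, matrixCoe_apply,
          Matrix.map_apply, algebraMap_smul, M.rationalBasis_apply, Submodule.coe_smul]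
      rw [h1]
      exact Submodule.coe_mem _
    have h2 : y = ((∑ j, v.repr ⟨y, hy⟩ j • v j : M.toSubmodule) : E) := by rw [v.sum_repr]
    rw [h2, Submodule.coe_sum, Finset.mul_sum]
    refine Submodule.sum_mem _ fun j _ => ?_
    rw [Submodule.coe_smul, mul_smul_comm]
    exact Submodule.smul_mem _ _ (hv j)
  · exact fun hc => ⟨_, M.matrixCoe_toMatrix v hc⟩

theorem LatticeModule.endo_toAddSubgroup_eq_map {x : E} (hx : Algebra.adjoin ℚ_[p] {x} = ⊤)
    (M : LatticeModule p x) (v : Module.Basis (Fin r) ℤ_[p] M.toSubmodule) :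
    M.endo.toAddSubgroup = (multiplierOrder (M.rationalBasis v)).toSubmodule.toAddSubgroup.map
      (Algebra.lmul ℚ_[p] E).toRingHom.toAddMonoidHom := by
  ext T
  constructor
  · rintro ⟨hT, hT'⟩
    have h1 : ∀ y, T y = T 1 * y := fun y => by
      rw [mul_comm, ← LatticeModule.endo_comm hx T hT', mul_one]
    refine ⟨T 1, (M.mem_multiplierOrder_iff v).2 fun y hy => ?_, ?_⟩
    · rw [← h1]
      exact hT y hy
    · ext y
      exact (h1 y).symm
  · rintro ⟨c, hc, rfl⟩
    exact ⟨(M.mem_multiplierOrder_iff v).1 hc, fun y => mul_left_comm c x y⟩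

theorem maximalOrderEnd_toAddSubgroup_eq_map :
    (maximalOrderEnd p E).toAddSubgroup = (integralClosure ℤ_[p] E).toSubmodule.toAddSubgroup.map
      (Algebra.lmul ℚ_[p] E).toRingHom.toAddMonoidHom := rfl

theorem LatticeModule.endo_le_maximalOrderEnd {x : E} (hx : Algebra.adjoin ℚ_[p] {x} = ⊤)
    (M : LatticeModule p x) (v : Module.Basis (Fin r) ℤ_[p] M.toSubmodule) :
    M.endo ≤ maximalOrderEnd p E := by
  intro T hT
  have h1 : T ∈ M.endo.toAddSubgroup := hT
  rw [M.endo_toAddSubgroup_eq_map hx v] at h1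
  obtain ⟨c, hc, rfl⟩ := h1
  exact ⟨c, multiplierOrder_le_integralClosure _ hc, rfl⟩

theorem LatticeModule.card_orderQuotient {x : E} (hx : Algebra.adjoin ℚ_[p] {x} = ⊤)
    (M : LatticeModule p x) (v : Module.Basis (Fin r) ℤ_[p] M.toSubmodule) :
    Nat.card (M.cls.OrderQuotient hx) =
      (multiplierOrder (M.rationalBasis v)).toSubmodule.toAddSubgroup.relIndex
        (integralClosure ℤ_[p] E).toSubmodule.toAddSubgroup := by
  have hinj : Function.Injective (Algebra.lmul ℚ_[p] E).toRingHom.toAddMonoidHom :=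
    Algebra.lmul_injective
  rw [← AddSubgroup.relIndex_map_map_of_injective _ _ hinj,
    ← M.endo_toAddSubgroup_eq_map hx v, ← maximalOrderEnd_toAddSubgroup_eq_map]
  rfl

end EndomorphismRings

/-! ### Estimates for differences of integral conjugates -/

section RootDifferences

variable {F : Type*} [NormedField F] [IsUltrametricDist F] {r : ℕ} {l : Fin r → F}

theorem norm_sub_le_one_of_norm_le_one (hl : ∀ i, ‖l i‖ ≤ 1) (i j : Fin r) :
    ‖l i - l j‖ ≤ 1 :=
  (by simpa [sub_eq_add_neg] using IsUltrametricDist.norm_add_le_max (l i) (-l j) :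
    ‖l i - l j‖ ≤ max ‖l i‖ ‖l j‖).trans (max_le (hl i) (hl j))

theorem norm_prod_erase_sub_le_norm_sub (hl : ∀ i, ‖l i‖ ≤ 1) {i j : Fin r} (hij : i ≠ j) :
    ‖∏ k ∈ Finset.univ.erase i, (l i - l k)‖ ≤ ‖l i - l j‖ := by
  rw [← Finset.mul_prod_erase _ _ (Finset.mem_erase.2 ⟨hij.symm, Finset.mem_univ j⟩), norm_mul,
    norm_prod]
  exact mul_le_of_le_one_right (norm_nonneg _) (Finset.prod_le_one (fun _ _ => norm_nonneg _)
    fun k _ => norm_sub_le_one_of_norm_le_one hl i k)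

theorem norm_prod_erase_sub_le_one (hl : ∀ i, ‖l i‖ ≤ 1) (i : Fin r) :
    ‖∏ k ∈ Finset.univ.erase i, (l i - l k)‖ ≤ 1 := by
  rw [norm_prod]
  exact Finset.prod_le_one (fun _ _ => norm_nonneg _)
    fun k _ => norm_sub_le_one_of_norm_le_one hl i k

theorem norm_rootDifferences_le (hl : ∀ i, ‖l i‖ ≤ 1) (i : Fin r) :
    ‖rootDifferences l‖ ≤ ‖∏ k ∈ Finset.univ.erase i, (l i - l k)‖ := by
  rw [rootDifferences, ← Finset.mul_prod_erase _ _ (Finset.mem_univ i), norm_mul]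
  refine mul_le_of_le_one_right (norm_nonneg _) ?_
  rw [norm_prod]
  exact Finset.prod_le_one (fun _ _ => norm_nonneg _) fun k _ => norm_prod_erase_sub_le_one hl k

/-- This is how `s_i > r val Disc` enters. The factor next to `a` is at least the discriminant in
norm, so for `r ≥ 2` one power of the discriminant can be cancelled; for `r = 1` that factor is an
empty product. -/
theorem lt_norm_rootDifferences (hl : ∀ i, ‖l i‖ ≤ 1) (hinj : Function.Injective l) (i : Fin r)
    {a : ℝ} (ha : 0 ≤ a)
    (h : a * ‖∏ k ∈ Finset.univ.erase i, (l i - l k)‖ < ‖rootDifferences l‖ ^ r) :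
    a < ‖rootDifferences l‖ := by
  have h1 := norm_rootDifferences_le hl i
  have h0 : 0 < ‖rootDifferences l‖ := norm_pos_iff.2 (rootDifferences_ne_zero hinj)
  have h2 : ‖rootDifferences l‖ ≤ 1 := h1.trans (norm_prod_erase_sub_le_one hl i)
  rcases Nat.lt_or_ge r 2 with hr | hr
  · obtain rfl : r = 1 := by have := i.pos; omega
    have : Finset.univ.erase i = ∅ := by
      ext k; simp [Subsingleton.elim k i]
    rw [this, Finset.prod_empty, norm_one, mul_one, pow_one] at h
    exact h
  · have h3 : ‖rootDifferences l‖ ^ r ≤ ‖rootDifferences l‖ ^ 2 :=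
      pow_le_pow_of_le_one h0.le h2 hr
    have h4 : a * ‖rootDifferences l‖ < ‖rootDifferences l‖ * ‖rootDifferences l‖ := by
      rw [← sq]
      exact (mul_le_mul_of_nonneg_left h1 ha).trans_lt (h.trans_le h3)
    exact lt_of_mul_lt_mul_right h4 h0.le

end RootDifferences

/-! ### From the valuation conditions to multiples of a unit -/

section Specialization

theorem mem_integralMultiples_iff {p : ℕ} [Fact p.Prime] {E : Type*} [CommRing E] [Algebra ℚ_[p] E]
    [Algebra ℤ_[p] E] [IsScalarTower ℤ_[p] ℚ_[p] E] {r : ℕ} {ev : Fin r → E →ₐ[ℚ_[p]] PadicAlgCl p}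
    (V : Module.Basis (Fin r) ℚ_[p] E) (hev : Function.Injective ev) (u : Eˣ) (y : E) :
    y ∈ integralMultiples p (u : E) ↔ ∀ i, ‖ev i y‖ ≤ ‖ev i u‖ := by
  constructor
  · rintro ⟨z, hz, rfl⟩ i
    rw [LinearMap.mulLeft_apply, map_mul, norm_mul]
    exact mul_le_of_le_one_right (norm_nonneg _)
      ((isIntegral_iff_forall_norm_emb_le_one ev V hev z).1 hz i)
  · intro h
    refine ⟨↑u⁻¹ * y, (isIntegral_iff_forall_norm_emb_le_one ev V hev _).2 fun i => ?_, by simp⟩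
    have h0 : 0 < ‖ev i u‖ := norm_pos_iff.2 (u.isUnit.map (ev i)).ne_zero
    refine le_of_mul_le_mul_left ?_ h0
    rw [← norm_mul, ← map_mul, Units.mul_inv_cancel_left, mul_one]
    exact h i

theorem pow_eq_rpow_of_pow_eq_inv {a b : ℝ} (ha : 0 ≤ a) (hb : 0 ≤ b) {n : ℕ} (hn : n ≠ 0)
    (h : a ^ n = b⁻¹) (k : ℕ) : a ^ k = b ^ (-(k / n : ℝ)) := by
  rw [← Real.pow_rpow_inv_natCast ha hn, h, ← Real.rpow_natCast, ← Real.rpow_mul (inv_nonneg.2 hb),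
    Real.inv_rpow hb, Real.rpow_neg hb]
  congr 2
  field_simp

variable {p : ℕ} [Fact p.Prime] {m : ℕ} {K : Fin m → Type*} [∀ i, Field (K i)]
  [∀ i, Algebra ℚ_[p] (K i)] [∀ i, FiniteDimensional ℚ_[p] (K i)] {r : ℕ}

theorem prod_rpow_sigma (e : Fin r ≃ Σ i, (K i →ₐ[ℚ_[p]] PadicAlgCl p)) (s : Fin m → ℝ) :
    ∏ j, (p : ℝ) ^ (-(s (e j).1)) =
      ((p : ℝ) ^ (∑ i, s i * (Module.finrank ℚ_[p] (K i) : ℝ)))⁻¹ := by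
  have hp : (0 : ℝ) < p := Nat.cast_pos.2 (Fact.out : p.Prime).pos
  rw [Equiv.prod_comp e fun q => (p : ℝ) ^ (-(s q.1)), Fintype.prod_sigma,
    Real.rpow_sum_of_pos hp, ← Finset.prod_inv_distrib]
  refine Finset.prod_congr rfl fun i _ => ?_
  change ∏ _σ, (p : ℝ) ^ (-(s i)) = _
  rw [Finset.prod_const, Finset.card_univ, AlgHom.card, Real.rpow_mul hp.le, Real.rpow_natCast,
    Real.rpow_neg hp.le, inv_pow]

/-- There is a unit whose integral multiples are the elements `y` with
`val y_i + val Z'(x_i) ≥ s_i` for all `i`. -/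
theorem exists_unit_norm_emb (hr : Module.finrank ℚ_[p] (∀ i, K i) = r)
    [∀ i, Algebra ℤ_[p] (K i)] [∀ i, IsScalarTower ℤ_[p] ℚ_[p] (K i)] {x : ∀ i, K i}
    (e : Fin r ≃ Σ i, (K i →ₐ[ℚ_[p]] PadicAlgCl p))
    (hx : Function.Injective fun j => sigmaEmb (e j) x)
    {ϖ : ∀ i, integralClosure ℤ_[p] (K i)} (hϖ : ∀ i, (Ideal.span {ϖ i}).IsMaximal)
    {s : Fin m → ℝ} (hs : ∀ i, ∃ k : ℕ, s i = k / ((Ideal.span {ϖ i}).ramificationIdx ℤ_[p] : ℕ)) :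
    (∀ i, aeval (x i) (derivative (minpolyProd p x)) ≠ 0) ∧
    ∃ u : (∀ i, K i)ˣ, ∀ j, ‖sigmaEmb (e j) (u : ∀ i, K i)‖ *
      ‖(e j).2 (aeval (x (e j).1) (derivative (minpolyProd p x)))‖ = (p : ℝ) ^ (-(s (e j).1)) := by
  have hZ : ∀ i, aeval (x i) (derivative (minpolyProd p x)) ≠ 0 := by
    intro i
    have σ : K i →ₐ[ℚ_[p]] PadicAlgCl p := IsAlgClosed.lift
    suffices h : ∀ q : Σ i, (K i →ₐ[ℚ_[p]] PadicAlgCl p),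
        aeval (x q.1) (derivative (minpolyProd p x)) ≠ 0 from h ⟨i, σ⟩
    intro q h0
    obtain ⟨j, rfl⟩ := e.surjective q
    have h1 := emb_aeval_derivative_minpolyProd hr e hx j
    rw [h0, map_zero] at h1
    refine Finset.prod_ne_zero_iff.2 (fun k hk => ?_) h1.symm
    exact sub_ne_zero.2 fun h => (Finset.mem_erase.1 hk).1 (hx h).symm
  refine ⟨hZ, ?_⟩
  choose k hk using hs
  have hϖ0 : ∀ i, (ϖ i : K i) ≠ 0 := by
    intro i h0
    obtain ⟨h1, h2⟩ := norm_emb_uniformizer_pow (IsAlgClosed.lift : K i →ₐ[ℚ_[p]] PadicAlgCl p)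
      (hϖ i)
    rw [h0, map_zero, norm_zero, zero_pow h1] at h2
    exact inv_ne_zero (Nat.cast_ne_zero.2 (Fact.out : p.Prime).ne_zero) h2.symm
  -- The unit is `ϖ_i ^ k_i / Z'(x_i)` with `s_i = k_i / e_i`.
  obtain ⟨u, hu⟩ : IsUnit (fun i => (ϖ i : K i) ^ k i /
      aeval (x i) (derivative (minpolyProd p x)) : ∀ i, K i) :=
    Pi.isUnit_iff.2 fun i => (div_ne_zero (pow_ne_zero _ (hϖ0 i)) (hZ i)).isUnit
  refine ⟨u, fun j => ?_⟩
  obtain ⟨h1, h2⟩ := norm_emb_uniformizer_pow (e j).2 (hϖ (e j).1)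
  rw [sigmaEmb_apply, hu, ← norm_mul, ← map_mul, div_mul_cancel₀ _ (hZ _), map_pow, norm_pow,
    hk (e j).1]
  exact pow_eq_rpow_of_pow_eq_inv (norm_nonneg _) (Nat.cast_nonneg _) h1 h2 _

/-- The condition at an embedding depends only on the factor `K i` that it comes from, and every
factor has an embedding. -/
theorem nearIdPolys_eq [∀ i, Algebra ℤ_[p] (K i)] [∀ i, IsScalarTower ℤ_[p] ℚ_[p] (K i)]
    {x : ∀ i, K i} (V : Module.Basis (Fin r) ℚ_[p] (∀ i, K i))
    (e : Fin r ≃ Σ i, (K i →ₐ[ℚ_[p]] PadicAlgCl p)) {s : Fin m → ℝ}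
    (hZ : ∀ i, aeval (x i) (derivative (minpolyProd p x)) ≠ 0) {u : (∀ i, K i)ˣ}
    (hu : ∀ j, ‖sigmaEmb (e j) (u : ∀ i, K i)‖ *
      ‖(e j).2 (aeval (x (e j).1) (derivative (minpolyProd p x)))‖ = (p : ℝ) ^ (-(s (e j).1))) :
    nearIdPolys r x s = {f : ℤ_[p][X] | f.degree < (r : WithBot ℕ) ∧
      aeval x f - x ∈ integralMultiples p (u : ∀ i, K i)} := by
  ext f
  refine and_congr_right fun _ => ?_
  rw [mem_integralMultiples_iff (ev := fun j => sigmaEmb (e j)) V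
    (sigmaEmb_injective.comp e.injective)]
  have hf : ∀ i, (aeval x f - x) i = aeval (x i) f - x i := fun i => by
    rw [Pi.sub_apply]
    congr 1
    exact (aeval_algHom_apply (Pi.evalAlgHom ℤ_[p] K i) x f).symm
  have key : ∀ j, ‖sigmaEmb (e j) (aeval x f - x)‖ ≤ ‖sigmaEmb (e j) (u : ∀ i, K i)‖ ↔
      ((s (e j).1 : ℝ) : WithTop ℝ) ≤ extVal p (aeval (x (e j).1) f - x (e j).1) +
        extVal p (aeval (x (e j).1) (derivative (minpolyProd p x))) := by
    intro j
    rw [coe_le_extVal_add_extVal_iff (e j).2 (hZ _), ← hu j, sigmaEmb_apply, hf,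
      mul_le_mul_iff_of_pos_right (norm_pos_iff.2 ((_root_.map_ne_zero _).2 (hZ _)))]
  simp_rw [key]
  constructor
  · exact fun h j => h _
  · intro h i
    obtain ⟨j, hj⟩ := e.surjective ⟨i, IsAlgClosed.lift⟩
    have h1 := h j
    rw [hj] at h1
    exact h1

end Specialization

end

/-! ### The theorem -/

theorem mainTheorem5 (p : ℕ) [Fact p.Prime] (m : ℕ) (K : Fin m → Type*) [∀ i, Field (K i)]
    [∀ i, Algebra ℚ_[p] (K i)] [∀ i, FiniteDimensional ℚ_[p] (K i)]
    [∀ i, Algebra ℤ_[p] (K i)] [∀ i, IsScalarTower ℤ_[p] ℚ_[p] (K i)]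
    (r : ℕ) (hr : Module.finrank ℚ_[p] (∀ i, K i) = r)
    (x : ∀ i, K i) (hx_int : ∀ i, IsIntegral ℤ_[p] (x i))
    (hx_gen : Algebra.adjoin ℚ_[p] {x} = ⊤)
    -- `ϖ i` is a uniformizer of `K i` and `e i` is the ramification index of `K i` over `ℚ_p`
    (ϖ : ∀ i, integralClosure ℤ_[p] (K i)) (hϖ : ∀ i, (Ideal.span {ϖ i}).IsMaximal)
    (e : Fin m → ℕ) (he : ∀ i, e i = (Ideal.span {ϖ i}).ramificationIdx ℤ_[p])
    (s : Fin m → ℝ) (hs : ∀ i, ∃ k : ℕ, s i = k / e i)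
    (hs_gt : ∀ i, (r : ℝ) * (valDisc p x : ℝ) < s i)
    [MeasurableSpace (Matrix (Fin r) (Fin r) ℤ_[p])] [BorelSpace (Matrix (Fin r) (Fin r) ℤ_[p])]
    -- the Haar probability measure on `Mat_r(ℤ_p)`
    (P : MeasureTheory.Measure (Matrix (Fin r) (Fin r) ℤ_[p])) [P.IsAddHaarMeasure]
    [MeasureTheory.IsProbabilityMeasure P]
    -- a class `C` with a basis of a representative, and the matrix `A` of `x` in that basis
    (C : LatticeClass p x) (M : LatticeModule p x) (hM : M.cls = C)
    (v : Module.Basis (Fin r) ℤ_[p] M.toSubmodule)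
    (A : Matrix (Fin r) (Fin r) ℤ_[p]) (hA : A = M.actionMatrix v) :
    -- the quotient `O_E / End(C)` makes sense and is finite
    C.endo hx_gen ≤ maximalOrderEnd p (∀ i, K i) ∧
    Finite (C.OrderQuotient hx_gen) ∧
    ∃ N₀ : ℕ, ∀ N : ℕ, N₀ ≤ N →
      MeasurableSet (conjugateSet A (nearIdPolys r x s) N) ∧
      P.real (conjugateSet A (nearIdPolys r x s) N) =
        (Nat.card (C.OrderQuotient hx_gen) : ℝ) /
        (p : ℝ) ^ ((∑ i, s i * (Module.finrank ℚ_[p] (K i) : ℝ)) +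
          (N : ℝ) * ((r : ℝ) ^ 2 - (r : ℝ))) := by

  classical
  subst hM hA
  have hcard : Nat.card (Σ i, (K i →ₐ[ℚ_[p]] PadicAlgCl p)) = r := card_sigma_algHom.trans hr
  let q : Fin r ≃ Σ i, (K i →ₐ[ℚ_[p]] PadicAlgCl p) := (Finite.equivFinOfCardEq hcard).symm
  let ev : Fin r → (∀ i, K i) →ₐ[ℚ_[p]] PadicAlgCl p := fun j => sigmaEmb (q j)
  have hev : Function.Injective ev := sigmaEmb_injective.comp q.injective
  have hx : Function.Injective fun j => ev j x := emb_injective_of_adjoin_eq_top hx_gen hev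
  have hA := M.matrixCoe_actionMatrix v
  have hp1 : (1 : ℝ) < p := Nat.one_lt_cast.2 (Fact.out : p.Prime).one_lt
  have hp0 : (0 : ℝ) < p := zero_lt_one.trans hp1
  obtain rfl : e = fun i => (Ideal.span {ϖ i}).ramificationIdx ℤ_[p] := funext he
  obtain ⟨hZ, u, hu⟩ := exists_unit_norm_emb hr q hx hϖ hs
  have hl : ∀ j, ‖ev j x‖ ≤ 1 := fun j =>
    (isIntegral_iff_norm_emb_le_one (q j).2 _).1 (hx_int (q j).1)
  have hlt : ∀ j, ‖ev j u‖ < ‖rootDifferences fun j => ev j x‖ := by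
    intro j
    refine lt_norm_rootDifferences hl hx j (norm_nonneg _) ?_
    rw [← emb_aeval_derivative_minpolyProd hr q hx j, hu j, norm_rootDifferences_eq hr q hx,
      ← Real.rpow_mul_natCast hp0.le]
    refine Real.rpow_lt_rpow_of_exponent_lt hp1 ?_
    linarith [hs_gt (q j).1]
  have hsub : ∀ i j, i ≠ j → ‖ev i u‖ < ‖ev i x - ev j x‖ := fun i j hij =>
    (hlt i).trans_le ((norm_rootDifferences_le hl i).trans
      (norm_prod_erase_sub_le_norm_sub hl hij))
  have hrel := M.card_orderQuotient hx_gen v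
  -- The discriminant is, up to sign, the product of `Z'` over all conjugates, so each factor pairs
  -- with `u` to give `p ^ (-s_i)`.
  have hprod : (∏ j, ‖ev j u‖) * ‖rootDifferences fun j => ev j x‖ =
      ((p : ℝ) ^ (∑ i, s i * (Module.finrank ℚ_[p] (K i) : ℝ)))⁻¹ := by
    rw [← prod_rpow_sigma q s, rootDifferences, norm_prod, ← Finset.prod_mul_distrib]
    refine Finset.prod_congr rfl fun j _ => ?_
    rw [← hu j, emb_aeval_derivative_minpolyProd hr q hx j]
  refine ⟨M.endo_le_maximalOrderEnd hx_gen v, ?_, ?_⟩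
  · refine Nat.finite_of_card_ne_zero ?_
    rw [hrel]
    exact (index_multiplesMatrix_ne_zero hx_gen hev hA hx (fun j => (hlt j).le) 0).2
  · obtain ⟨N₀, hN₀⟩ := measureReal_conjugateSet hx_gen hev hA hx (fun j => (hlt j).le) hsub P
    refine ⟨N₀, fun N hN => ?_⟩
    rw [nearIdPolys_eq (M.rationalBasis v) q hZ hu]
    refine ⟨(hN₀ N hN).1, (hN₀ N hN).2.trans ?_⟩
    rw [hprod, hrel, ← div_eq_mul_inv, div_div, Real.rpow_add hp0]
    congr 2
    rw [← Real.rpow_natCast]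
    congr 1
    -- The truncated difference `r * r - r` is the true one because `r ≤ r * r`.
    rw [Nat.cast_mul, Nat.cast_sub (Nat.le_mul_self r), Nat.cast_mul, sq]
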